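/- **Setting.** A rooted WRAP (weighted ring augmentation) instance $(G,L,c,r,e_r)$ consists of a cycle $G=(V,E)$ with at least two vertices (two parallel edges if $|V|=2$), a set $L\subseteq\binom V2$ of links with costs $c\colon L\to\mathbb R_{\ge 0}$, a root $r\in V$, and an edge $e_r\in E$ incident to $r$. For an edge or link set $K$ and $C\subseteq V$, $\delta_K(C)$ denotes the set of elements of $K$ with exactly one endpoint in $C$. Let $\mathcal C_G=\{C\subseteq V\setminus\{r\} : |\delta_E(C)|=2\}$ be the set of 2-cuts. A set $S\subseteq L$ is a *WRAP solution* if adding $S$ to $G$ (keeping parallel edges) gives a 3-edge-connected multigraph. A directed link is a pair $(u,v)\in V\times V$ with $u\ne v$; it covers $C\in\mathcal C_G$ if $u\notin C$ and $v\in C$. A set $\vec F$ of directed links is a *directed WRAP solution* if every $C\in\mathcal C_G$ is covered by some link of $\vec F$. A *shortening* of $(u,v)$ is a pair $(s,v)$ with $s\neq v$ and $s$ on the unique $u$-$v$ path in $(V,E\setminus\{e_r\})$; it is strict if $s\neq u$. A *shadow* of a link $\{u,v\}$ is a shortening of $(u,v)$ or of $(v,u)$, and $\mathrm{shadows}(L)$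 is the set of all shadows of links of $L$. A directed WRAP solution $\vec F$ is *non-shortenable* if deleting any of its links, or replacing any of its links by a strict shortening of it, yields a set that is not a directed WRAP solution (then $(V,\vec F)$ is an arborescence rooted at $r$). For a non-shortenable directed WRAP solution $\vec F$, a link $(u,v)\in\vec F$ is *responsible* for $C\in\mathcal C_G$ if it covers $C$ and no link on the $r$-$u$ path in $(V,\vec F)$ covers $C$. For $K\subseteq L$, $\mathrm{Drop}_{\vec F}(K)$ is the set of those $\vec\ell\in\vec F$ such that $\delta_K(C)\ne\emptyset$ for every $C\in\mathcal C_G$ for which $\vec\ell$ is responsible. For a positive integer $\alpha$, a set $K\subseteq L$ is *$\alpha$-thin* if there is an inclusion-wise maximal laminar family $\mathcal L\subseteq\mathcal C_G$ (any two members are disjoint or nested) with $|\delta_K(C)|\le\alpha$ for all $C\in\mathcal L$. **Theorem (decomposition theorem).** Let $(G,L,c,r,e_r)$ be a rooted WRAP instance, let $S\subseteq L$ be a WRAP solution, and let $\vec F_0\subseteq\mathrm{shadows}(L)$ be a non-shortenable directed WRAP solution. Let each $\vec\ell\in\vec F_0$ have the cost $c(\vec\ell)=c(\ell)$ of a link $\ell\in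 L$ of which it is a shadow (chosen arbitrarily if there are several), and let $c(\vec R)=\sum_{\vec\ell\in\vec R}c(\vec\ell)$ for $\vec R\subseteq\vec F_0$. Then for every real $\varepsilon>0$ there exist a partition $\mathcal K$ of $S$ into $4\lceil 1/\varepsilon\rceil$-thin sets and a set $\vec R\subseteq\vec F_0$ such that 1. for every $\vec\ell\in\vec F_0\setminus\vec R$ there is some $K\in\mathcal K$ with $\vec\ell\in\mathrm{Drop}_{\vec F_0}(K)$, and 2. $c(\vec R)\le\varepsilon\cdot c(\vec F_0)$. -/

import Mathlib

/-- The pair `z` has exactly one endpoint in the vertex set `U` (when `z` is not a loop). -/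
def Crosses {V : Type*} (U : Set V) (z : Sym2 V) : Prop :=
  (∃ x ∈ z, x ∈ U) ∧ (∃ y ∈ z, y ∉ U)

/-- `δ(U)` in the multigraph with edge set `E` and endpoint map `ends`. -/
def cutEdges {V E : Type*} (ends : E → Sym2 V) (U : Set V) : Set E :=
  {e | Crosses U (ends e)}

/-- `δ_K(U)` for a set `K` of links. -/
def cutLinks {V : Type*} (K : Finset (Sym2 V)) (U : Set V) : Set (Sym2 V) :=
  {l | l ∈ K ∧ Crosses U l}

/-- The multigraph is `k`-edge-connected: every nonempty proper vertex subset is left by at least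
`k` edges. -/
def IsEdgeConnected {V E : Type*} (ends : E → Sym2 V) (k : ℕ) : Prop :=
  ∀ U : Set V, U.Nonempty → U ≠ Set.univ → (k : ℕ∞) ≤ (cutEdges ends U).encard

/-- The multigraph is a cycle of some length `n ≥ 2` (two parallel edges if `n = 2`). -/
def IsCycleMultigraph {V E : Type*} (ends : E → Sym2 V) : Prop :=
  ∃ (n : ℕ) (_ : 2 ≤ n) (φ : ZMod n ≃ V) (ψ : ZMod n ≃ E),
    ∀ i : ZMod n, ends (ψ i) = s(φ i, φ (i + 1))

/-- A family of sets is laminar if any two of its members are disjoint or nested. -/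
def IsLaminarFamily {V : Type*} (𝓛 : Set (Set V)) : Prop :=
  ∀ A ∈ 𝓛, ∀ B ∈ 𝓛, A ⊆ B ∨ B ⊆ A ∨ Disjoint A B

/-- The directed link `f = (u, v)` enters `C`. -/
def Enters {V : Type*} (f : V × V) (C : Set V) : Prop :=
  f.1 ∉ C ∧ f.2 ∈ C

/-- The list `p` of vertices is a directed path from `a` to `b` in the digraph `(V, F)`;
its links are the members of `p.zip p.tail`. -/
def IsDirectedPath {V : Type*} (F : Finset (V × V)) (a b : V) (p : List V) : Prop :=
  p.head? = some a ∧ p.getLast? = some b ∧ p.Nodup ∧ ∀ f ∈ p.zip p.tail, f ∈ F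

/-- An instance `(G, L, c, r, e_r)` of the rooted weighted ring augmentation problem, where
`G = (V, E)` is a cycle, `L` a set of links with nonnegative costs `c`, `r` a vertex and `e_r` an
edge incident to `r`. (Values of `c` outside `L` are irrelevant.) -/
structure RootedWRAP (V E : Type*) where
  ends : E → Sym2 V
  isCycle : IsCycleMultigraph ends
  L : Finset (Sym2 V)
  not_isDiag : ∀ l ∈ L, ¬ l.IsDiag
  c : Sym2 V → ℝ
  c_nonneg : ∀ l ∈ L, 0 ≤ c l
  r : V
  e_r : E
  r_mem : r ∈ ends e_r

namespace RootedWRAP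

variable {V E : Type*} (I : RootedWRAP V E)

/-- `C_G`: the 2-cuts of the ring, represented by their sides avoiding the root. -/
def twoCuts : Set (Set V) :=
  {C | I.r ∉ C ∧ (cutEdges I.ends C).encard = 2}

/-- `S ⊆ L` is a WRAP solution: adding (possibly parallel) links of `S` to the cycle, which has
edge-connectivity two, yields a 3-edge-connected multigraph. -/
def IsSolution (S : Finset (Sym2 V)) : Prop :=
  S ⊆ I.L ∧
    IsEdgeConnected (Sum.elim I.ends (fun l : {l : Sym2 V // l ∈ S} => (l : Sym2 V))) 3

/-- The set `F` of directed links is a directed solution: every 2-cut is entered by some member. -/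
def IsDirectedSolution (F : Finset (V × V)) : Prop :=
  (∀ f ∈ F, f.1 ≠ f.2) ∧ ∀ C ∈ I.twoCuts, ∃ f ∈ F, Enters f C

/-- The graph `(V, E ∖ {e_r})`. -/
def ringWithoutRootEdge : SimpleGraph V where
  Adj x y := x ≠ y ∧ ∃ e : E, e ≠ I.e_r ∧ I.ends e = s(x, y)
  symm := ⟨fun _ _ h => ⟨h.1.symm, by
    obtain ⟨e, he, h'⟩ := h.2
    exact ⟨e, he, h'.trans Sym2.eq_swap⟩⟩⟩
  loopless := ⟨fun _ h => h.1 rfl⟩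

/-- `g = (s, t)` is a shortening of `f = (u, v)`: `s ≠ t`, `t = v`, and `s` lies on the `u`-`v` path
in `(V, E ∖ {e_r})`. -/
def IsShortening (g f : V × V) : Prop :=
  g.1 ≠ g.2 ∧ g.2 = f.2 ∧
    ∃ p : I.ringWithoutRootEdge.Walk f.1 f.2, p.IsPath ∧ g.1 ∈ p.support

/-- The directed link `f` is a shadow of the link `l`. -/
def IsShadow (f : V × V) (l : Sym2 V) : Prop :=
  ∃ u v : V, u ≠ v ∧ l = s(u, v) ∧ I.IsShortening f (u, v)

/-- The set of all shadows of links in `L`. -/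
def shadows : Set (V × V) :=
  {f | ∃ l ∈ I.L, I.IsShadow f l}

/-- `F` is a non-shortenable directed solution: deleting any of its links, or replacing it by a
strict shortening, destroys being a directed solution. -/
def IsNonShortenable [DecidableEq V] (F : Finset (V × V)) : Prop :=
  I.IsDirectedSolution F ∧
    ∀ f ∈ F, ¬ I.IsDirectedSolution (F.erase f) ∧
      ∀ g : V × V, I.IsShortening g f → g ≠ f → ¬ I.IsDirectedSolution (insert g (F.erase f))

/-- The 2-cuts for which `f = (u, v)` is responsible: `f` covers the cut and no link of the
`r`-`u` path in `(V, F)` does. (For non-shortenable `F`, `(V, F)` is an arborescence rooted at `r`,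
so this path exists and is unique.) -/
def responsible (F : Finset (V × V)) (f : V × V) : Set (Set V) :=
  {C | C ∈ I.twoCuts ∧ Enters f C ∧
    ∃ p : List V, IsDirectedPath F I.r f.1 p ∧ ∀ g ∈ p.zip p.tail, ¬ Enters g C}

/-- `Drop_F(K)`: the links of `F` such that `K` covers all cuts they are responsible for. -/
def drop (F : Finset (V × V)) (K : Finset (Sym2 V)) : Set (V × V) :=
  {f | f ∈ F ∧ ∀ C ∈ I.responsible F f, (cutLinks K C).Nonempty}

/-- `K` is `α`-thin: some inclusion-wise maximal laminar family of 2-cuts has all its members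
crossed by at most `α` links of `K`. -/
def IsThin (α : ℕ) (K : Finset (Sym2 V)) : Prop :=
  ∃ 𝓛 : Set (Set V),
    Maximal (fun 𝓜 : Set (Set V) => 𝓜 ⊆ I.twoCuts ∧ IsLaminarFamily 𝓜) 𝓛 ∧
      ∀ C ∈ 𝓛, (cutLinks K C).encard ≤ α

/-- `orig` assigns to every directed link of `F` a link of `L` of which it is a shadow, and
from which it inherits its cost. -/
def IsOrigin (F : Finset (V × V)) (orig : V × V → Sym2 V) : Prop :=
  ∀ f ∈ F, orig f ∈ I.L ∧ I.IsShadow f (orig f)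

/-- The cost of a set of directed links, each having the cost of its original link. -/
def dirCost (orig : V × V → Sym2 V) (F : Finset (V × V)) : ℝ :=
  ∑ f ∈ F, I.c (orig f)

end RootedWRAP

/-! Cutting the ring at `e_r` turns the vertices into positions 0, …, N with the root at 0, and the
2-cuts into the intervals [c, d] with 1 ≤ c ≤ d ≤ N. Peeling off longest covered runs splits S into
festoons with laminar intervals (`exists_festoon_partition`). A non-shortenable solution is an
arborescence, and its link into v is responsible only for intervals around v without a proper
ancestor of v (`responsible_subset`). Let D v u mean that no proper ancestor of v lies between v and
u; non-shortenability makes D antisymmetric (`noAncestorBetween_antisymm`).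

For each v, a chain of growing festoons, each reaching with a link end into the interval of the
previous one, leads from a festoon with a link ending at v to one whose interval contains some u
with ¬ D v u. If the whole chain lies in one class, that class covers every cut for which the link
into v is responsible (`exists_not_subset`, `subset_of_not_crosses`). By antisymmetry each festoon
is passed by the chain of at most one v, so the arcs of all chains form a forest; the level of a
festoon counts the changes of user on its way to the root.

Let q = ⌈1/ε⌉. Deleting the arcs whose level lies in the cheapest residue class modulo q sacrifices
at most an ε-fraction of the cost; the components that remain are the classes. For each component
there is a maximal laminar family of intervals (`Compatible.exists_split`) each crossed by at most q
of its festoons (`card_crossing_le`), and a festoon contributes at most 4 crossing links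
(`card_crosses_le`), which gives 4q. -/

/-! ### Festoons on a line. -/

/-- A link with end positions `lt x < rt x` has exactly one endpoint in the interval `[c, d]`. -/
def LinkCrosses {ι : Type*} (lt rt : ι → ℕ) (c d : ℕ) (x : ι) : Prop :=
  (lt x < c ∧ c ≤ rt x ∧ rt x ≤ d) ∨ (c ≤ lt x ∧ lt x ≤ d ∧ d < rt x)

/-- `X` is an inclusion-wise minimal set of links within `[a, b]` that covers all the gaps
`{p, p + 1}` of `[a, b]`. -/
structure IsFestoon {ι : Type*} (lt rt : ι → ℕ) (X : Finset ι) (a b : ℕ) : Prop where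
  bounds_lt : a < b
  mem : ∀ x ∈ X, a ≤ lt x ∧ rt x ≤ b
  cover : ∀ p, a ≤ p → p < b → ∃ x ∈ X, lt x ≤ p ∧ p < rt x
  minimal : ∀ x ∈ X, ∃ p, lt x ≤ p ∧ p < rt x ∧ ∀ y ∈ X, lt y ≤ p → p < rt y → y = x

namespace IsFestoon

variable {ι : Type*} {lt rt : ι → ℕ} {X : Finset ι} {a b : ℕ}

/-- If the festoon extended beyond d, a link over the gap at d that does not cross [c, d] would span
all of [c, d], including the private gap of x. Once b ≤ d, a link over the gap at c - 1 would have
to cross. -/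
theorem subset_of_not_crosses (h : IsFestoon lt rt X a b) {c d : ℕ}
    (hX : ∀ x ∈ X, ¬ LinkCrosses lt rt c d x) {x : ι} (hx : x ∈ X)
    (hxc : (c ≤ lt x ∧ lt x ≤ d) ∨ (c ≤ rt x ∧ rt x ≤ d)) : c ≤ a ∧ b ≤ d := by
  obtain ⟨p, hp1, hp2, hp⟩ := h.minimal x hx
  have hxm := h.mem x hx
  have hxn := hX x hx
  unfold LinkCrosses at hX hxn
  by_cases hd : d < b
  · obtain ⟨z, hz, hz1, hz2⟩ := h.cover d (by omega) hd
    have hzn := hX z hz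
    have := hp z hz (by omega) (by omega)
    subst this
    omega
  · by_cases hc : a < c
    · obtain ⟨z, hz, hz1, hz2⟩ := h.cover (c - 1) (by omega) (by omega)
      have hzn := hX z hz
      have hzm := h.mem z hz
      omega
    · omega

/-- Of three links over a common gap, the one reaching furthest left and the one reaching furthest
right cover everything that a third covers, leaving it no private gap. -/
theorem card_gap_le (h : IsFestoon lt rt X a b) (p : ℕ) :
    (X.filter fun x => lt x ≤ p ∧ p < rt x).card ≤ 2 := by
  by_contra! hc
  obtain ⟨x, hx, y, hy, z, hz, hxy, hxz, hyz⟩ := Finset.two_lt_card.1 hc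
  simp only [Finset.mem_filter] at hx hy hz
  obtain ⟨i, hi1, hi2, hi⟩ := h.minimal x hx.1
  obtain ⟨j, hj1, hj2, hj⟩ := h.minimal y hy.1
  obtain ⟨k, hk1, hk2, hk⟩ := h.minimal z hz.1
  have e1 : ¬ (lt y ≤ i ∧ i < rt y) := fun e => hxy (hi y hy.1 e.1 e.2).symm
  have e2 : ¬ (lt z ≤ i ∧ i < rt z) := fun e => hxz (hi z hz.1 e.1 e.2).symm
  have e3 : ¬ (lt x ≤ j ∧ j < rt x) := fun e => hxy (hj x hx.1 e.1 e.2)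
  have e4 : ¬ (lt z ≤ j ∧ j < rt z) := fun e => hyz (hj z hz.1 e.1 e.2).symm
  have e5 : ¬ (lt x ≤ k ∧ k < rt x) := fun e => hxz (hk x hx.1 e.1 e.2)
  have e6 : ¬ (lt y ≤ k ∧ k < rt y) := fun e => hyz (hk y hy.1 e.1 e.2)
  omega

-- A link crossing [c, d] passes over the gap before c or the gap after d.
open Classical in
theorem card_crosses_le (h : IsFestoon lt rt X a b) (c d : ℕ) :
    (X.filter fun x => LinkCrosses lt rt c d x).card ≤ 4 := by
  have hsub : (X.filter fun x => LinkCrosses lt rt c d x) ⊆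
      (X.filter fun x => lt x ≤ c - 1 ∧ c - 1 < rt x) ∪ (X.filter fun x => lt x ≤ d ∧ d < rt x) := by
    intro x hx
    simp only [Finset.mem_filter, Finset.mem_union] at hx ⊢
    unfold LinkCrosses at hx
    obtain ⟨hx, h | h⟩ := hx
    · exact Or.inl ⟨hx, by omega, by omega⟩
    · exact Or.inr ⟨hx, by omega, by omega⟩
  have := Finset.card_le_card hsub
  have h1 := h.card_gap_le (c - 1)
  have h2 := h.card_gap_le d
  have := Finset.card_union_le (X.filter fun x => lt x ≤ c - 1 ∧ c - 1 < rt x)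
    (X.filter fun x => lt x ≤ d ∧ d < rt x)
  omega

end IsFestoon

open Classical in
/-- A longest run of gaps covered by `S`, and a festoon in `S` covering it. -/
theorem exists_maximal_festoon {ι : Type*} (lt rt : ι → ℕ) (S : Finset ι)
    (hS : ∀ x ∈ S, lt x < rt x) (hne : S.Nonempty) :
    ∃ X ⊆ S, X.Nonempty ∧ ∃ a b, IsFestoon lt rt X a b ∧
      ∀ a' b', a' < b' → (∀ p, a' ≤ p → p < b' → ∃ x ∈ S, lt x ≤ p ∧ p < rt x) →
        b' < a ∨ b < a' ∨ (a ≤ a' ∧ b' ≤ b) := by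
  let Run : ℕ × ℕ → Prop := fun z =>
    z.1 < z.2 ∧ ∀ p, z.1 ≤ p → p < z.2 → ∃ x ∈ S, lt x ≤ p ∧ p < rt x
  let B := S.sup rt
  have hB : ∀ z, Run z → z.2 ≤ B := by
    intro z hz
    obtain ⟨x, hx, -, h2⟩ := hz.2 (z.2 - 1) (by have := hz.1; omega) (by have := hz.1; omega)
    have : rt x ≤ B := Finset.le_sup hx
    omega
  let T := ((Finset.range (B + 1)) ×ˢ (Finset.range (B + 1))).filter Run
  have hT : ∀ z, Run z → z ∈ T := by
    intro z hz
    have := hB z hz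
    have := hz.1
    simp only [T, Finset.mem_filter, Finset.mem_product, Finset.mem_range]
    exact ⟨⟨by omega, by omega⟩, hz⟩
  obtain ⟨x₀, hx₀⟩ := hne
  have hT0 : T.Nonempty := ⟨(lt x₀, rt x₀), hT _ ⟨hS x₀ hx₀, fun p h1 h2 => ⟨x₀, hx₀, h1, h2⟩⟩⟩
  obtain ⟨⟨a, b⟩, hab, hmax⟩ := Finset.exists_max_image T (fun z => z.2 - z.1) hT0
  have hrun : Run (a, b) := (Finset.mem_filter.1 hab).2
  have hlt : a < b := hrun.1
  have key : ∀ a' b', a' < b' → (∀ p, a' ≤ p → p < b' → ∃ x ∈ S, lt x ≤ p ∧ p < rt x) →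
        b' < a ∨ b < a' ∨ (a ≤ a' ∧ b' ≤ b) := by
    intro a' b' h1 h2
    by_contra! hcon
    -- Runs that share even a single position merge, and here the union would be longer than the
    -- longest run.
    have hr : Run (min a a', max b b') := by
      refine ⟨by simp; omega, fun p hp1 hp2 => ?_⟩
      simp only at hp1 hp2
      by_cases h : a ≤ p ∧ p < b
      · exact hrun.2 p h.1 h.2
      · exact h2 p (by omega) (by omega)
    have := hmax _ (hT _ hr)
    simp only at this
    omega
  let W := S.powerset.filter fun X => ∀ p, a ≤ p → p < b → ∃ x ∈ X, lt x ≤ p ∧ p < rt x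
  have hW : W.Nonempty := ⟨S, Finset.mem_filter.2 ⟨Finset.mem_powerset_self S, hrun.2⟩⟩
  obtain ⟨X, hX, hmin⟩ := Finset.exists_min_image W Finset.card hW
  obtain ⟨hXS, hXc⟩ := Finset.mem_filter.1 hX
  rw [Finset.mem_powerset] at hXS
  -- A link without a private gap could be erased, against the minimal cardinality of X.
  have hpriv : ∀ x ∈ X, ∃ p, a ≤ p ∧ p < b ∧ lt x ≤ p ∧ p < rt x ∧
      ∀ y ∈ X, lt y ≤ p → p < rt y → y = x := by
    intro x hx
    by_contra! hcon
    have : X.erase x ∈ W := by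
      refine Finset.mem_filter.2 ⟨Finset.mem_powerset.2 ((Finset.erase_subset _ _).trans hXS), ?_⟩
      intro p hp1 hp2
      obtain ⟨y, hy, hy1, hy2⟩ := hXc p hp1 hp2
      by_cases hyx : y = x
      · subst hyx
        obtain ⟨z, hz, hz1, hz2, hzy⟩ := hcon p hp1 hp2 hy1 hy2
        exact ⟨z, Finset.mem_erase.2 ⟨hzy, hz⟩, hz1, hz2⟩
      · exact ⟨y, Finset.mem_erase.2 ⟨hyx, hy⟩, hy1, hy2⟩
    have h1 := hmin _ this
    have h2 := Finset.card_erase_lt_of_mem hx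
    omega
  obtain ⟨x₁, hx₁, -⟩ := hXc a le_rfl hlt
  refine ⟨X, hXS, ⟨x₁, hx₁⟩, a, b, ⟨hlt, ?_, hXc, ?_⟩, key⟩
  · intro x hx
    obtain ⟨p, hp1, hp2, hp3, hp4, -⟩ := hpriv x hx
    have := key (lt x) (rt x) (by omega) (fun p h1 h2 => ⟨x, hXS hx, h1, h2⟩)
    omega
  · intro x hx
    obtain ⟨p, -, -, hp3, hp4, h⟩ := hpriv x hx
    exact ⟨p, hp3, hp4, h⟩

open Classical in
/-- Every set of links can be partitioned into festoons with laminar intervals. -/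
theorem exists_festoon_partition {ι : Type*} (lt rt : ι → ℕ) (S : Finset ι)
    (hS : ∀ x ∈ S, lt x < rt x) :
    ∃ (g : ι → ℕ) (lo hi : ℕ → ℕ),
      (∀ x ∈ S, IsFestoon lt rt (S.filter fun y => g y = g x) (lo (g x)) (hi (g x))) ∧
      ∀ x ∈ S, ∀ y ∈ S, g x < g y → hi (g y) < lo (g x) ∨ hi (g x) < lo (g y) ∨
        (lo (g x) ≤ lo (g y) ∧ hi (g y) ≤ hi (g x)) := by
  induction S using Finset.strongInduction with
  | H S ih =>
  rcases S.eq_empty_or_nonempty with rfl | hne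
  · exact ⟨fun _ => 0, fun _ => 0, fun _ => 0, by simp, by simp⟩
  obtain ⟨X, hXS, hXne, a, b, hX, hmax⟩ := exists_maximal_festoon lt rt S hS hne
  have hss : S \ X ⊂ S := Finset.sdiff_ssubset hXS hXne
  obtain ⟨g, lo, hi, h1, h2⟩ := ih (S \ X) hss (fun x hx => hS x (hss.1 hx))
  -- The longest run gets index 0 and all later ones shift up by one. Each later festoon interval is
  -- a covered run of S, so `hmax` gives laminarity with it.
  refine ⟨fun x => if x ∈ X then 0 else g x + 1, fun i => if i = 0 then a else lo (i - 1),
    fun i => if i = 0 then b else hi (i - 1), ?_, ?_⟩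
  · intro x hx
    by_cases hxX : x ∈ X
    · have : (S.filter fun y => (if y ∈ X then 0 else g y + 1) = if x ∈ X then 0 else g x + 1)
          = X := by
        ext y
        by_cases hy : y ∈ X
        · simp [hxX, hy, hXS hy]
        · simp [hxX, hy]
      rw [this]
      simpa [hxX] using hX
    · have : (S.filter fun y => (if y ∈ X then 0 else g y + 1) = if x ∈ X then 0 else g x + 1)
          = (S \ X).filter fun y => g y = g x := by
        ext y
        by_cases hy : y ∈ X
        · simp [hxX, hy]
        · simp [hxX, hy]
      rw [this]
      simpa [hxX] using h1 x (Finset.mem_sdiff.2 ⟨hx, hxX⟩)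
  · intro x hx y hy hlt
    by_cases hyX : y ∈ X
    · simp [hyX] at hlt
    have hy' := Finset.mem_sdiff.2 ⟨hy, hyX⟩
    by_cases hxX : x ∈ X
    · have hf := h1 y hy'
      have := hmax (lo (g y)) (hi (g y)) hf.bounds_lt (fun p hp1 hp2 => by
        obtain ⟨z, hz, hz'⟩ := hf.cover p hp1 hp2
        exact ⟨z, hss.1 (Finset.mem_filter.1 hz).1, hz'⟩)
      simpa [hxX, hyX] using this
    · have := h2 x (Finset.mem_sdiff.2 ⟨hx, hxX⟩) y hy' (by simpa [hxX, hyX] using hlt)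
      simpa [hxX, hyX] using this

/-! ### Chains of festoons, their users and levels. -/

/-- A laminar system of festoon intervals `[lo i, hi i]`, with `IsEnd i p` saying that `p` is an
endpoint of a link of the `i`-th festoon, together with sets `D v` of descendants; larger
intervals have smaller indices. -/
structure FestoonSystem where
  Used : ℕ → Prop
  lo : ℕ → ℕ
  hi : ℕ → ℕ
  IsEnd : ℕ → ℕ → Prop
  mem_of_isEnd : ∀ i p, Used i → IsEnd i p → lo i ≤ p ∧ p ≤ hi i
  exists_isEnd : ∀ i, Used i → ∃ p, IsEnd i p
  laminar : ∀ i j, Used i → Used j → i < j →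
    hi j < lo i ∨ hi i < lo j ∨ (lo i ≤ lo j ∧ hi j ≤ hi i)
  Vert : ℕ → Prop
  D : ℕ → ℕ → Prop
  D_antisymm : ∀ v w, Vert v → Vert w → D v w → D w v → v = w
  not_D_zero : ∀ v, Vert v → ¬ D v 0
  start : ℕ → ℕ
  start_used : ∀ v, Vert v → Used (start v)
  start_isEnd : ∀ v, Vert v → IsEnd (start v) v
  progress : ∀ i, Used i → lo i ≠ 0 → ∃ j, Used j ∧ j < i ∧ ∃ p, lo i ≤ p ∧ p ≤ hi i ∧ IsEnd j p

namespace FestoonSystem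

variable (A : FestoonSystem)

/-- The festoon `j` is larger than `i` and tangled with it. -/
def Tangled (i j : ℕ) : Prop :=
  A.Used j ∧ j < i ∧ ∃ p, A.lo i ≤ p ∧ p ≤ A.hi i ∧ A.IsEnd j p

/-- The vertex `v` lies in the interval of the festoon `i`, which consists of descendants of `v`. -/
def Label (v i : ℕ) : Prop :=
  A.Vert v ∧ A.Used i ∧ A.lo i ≤ v ∧ v ≤ A.hi i ∧ ∀ u, A.lo i ≤ u → u ≤ A.hi i → A.D v u

/-- The interval of the festoon `j` contains a non-descendant of `v`. -/
def Leaves (v j : ℕ) : Prop :=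
  ∃ u, A.lo j ≤ u ∧ u ≤ A.hi j ∧ ¬ A.D v u

/-- `j` is the smallest festoon tangled with `i` that leaves the descendants of `v`, or, if there
is none, the largest festoon tangled with `i`. -/
def IsStep (v i j : ℕ) : Prop :=
  A.Tangled i j ∧ ((A.Leaves v j ∧ ∀ k, A.Tangled i k → A.Leaves v k → k ≤ j) ∨
    ((∀ k, A.Tangled i k → ¬ A.Leaves v k) ∧ ∀ k, A.Tangled i k → j ≤ k))

open Classical in
/-- The festoon that follows `i` in the chain of `v`. -/
noncomputable def step (v i : ℕ) : ℕ :=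
  if h : ∃ j, A.IsStep v i j then h.choose else i

open Classical in
/-- The chain of festoons leading from `v` to a non-descendant of `v`. -/
noncomputable def chain (v : ℕ) : ℕ → ℕ
  | 0 => A.start v
  | m + 1 => if A.Label v (chain v m) then A.step v (chain v m) else chain v m

/-- The chain of `v` uses the arc leaving `i`. -/
def Uses (v i : ℕ) : Prop :=
  A.Label v i ∧ ∃ m, A.chain v m = i

open Classical in
/-- The head of the arc leaving `i`. -/
noncomputable def parent (i : ℕ) : ℕ :=
  if h : ∃ v, A.Uses v i then A.step h.choose i else i

open Classical in
/-- The number of different users of the arcs on the directed path from `i`. -/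
noncomputable def level (i : ℕ) : ℕ :=
  if _h : A.parent i < i then
    level (A.parent i) + if ∃ v, A.Uses v i ∧ A.Uses v (A.parent i) then 0 else 1
  else 0
termination_by i

/-- The arc leaving `i` survives the deletion of the residue class `s` of levels modulo `q`. -/
def Kept (q s i : ℕ) : Prop :=
  (∃ v, A.Uses v i) ∧ A.level i % q ≠ s

variable {A}

theorem exists_isStep {v i : ℕ} (h : A.Label v i) : ∃ j, A.IsStep v i j := by
  classical
  have h0 : A.lo i ≠ 0 := fun h0 => A.not_D_zero v h.1 (h.2.2.2.2 0 (by omega) (by omega))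
  have hex : ∃ j, A.Tangled i j := by
    obtain ⟨j, hj⟩ := A.progress i h.2.1 h0
    exact ⟨j, hj⟩
  by_cases hl : ∃ j, A.Tangled i j ∧ A.Leaves v j
  · obtain ⟨j₀, hj₀⟩ := hl
    have hs := Nat.findGreatest_spec (P := fun j => A.Tangled i j ∧ A.Leaves v j) (n := i)
      hj₀.1.2.1.le hj₀
    exact ⟨_, hs.1, Or.inl ⟨hs.2, fun k hk hk' => Nat.le_findGreatest hk.2.1.le ⟨hk, hk'⟩⟩⟩
  · exact ⟨Nat.find hex, Nat.find_spec hex, Or.inr ⟨fun k hk hk' => hl ⟨k, hk, hk'⟩,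
      fun k hk => Nat.find_min' hex hk⟩⟩

theorem isStep_step {v i : ℕ} (h : A.Label v i) : A.IsStep v i (A.step v i) := by
  have := exists_isStep h
  rw [step, dif_pos this]
  exact this.choose_spec

/-- Both vertices lie in the interval of i, so each is a D-descendant of the other. -/
theorem Label.unique {v w i : ℕ} (h : A.Label v i) (h' : A.Label w i) : v = w :=
  A.D_antisymm v w h.1 h'.1 (h.2.2.2.2 w h'.2.2.1 h'.2.2.2.1) (h'.2.2.2.2 v h.2.2.1 h.2.2.2.1)

theorem Tangled.subset {i j : ℕ} (hi : A.Used i) (h : A.Tangled i j) :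
    A.lo j ≤ A.lo i ∧ A.hi i ≤ A.hi j := by
  obtain ⟨hj, hlt, p, h1, h2, hp⟩ := h
  have := A.mem_of_isEnd j p hj hp
  have := A.laminar j i hj hi hlt
  omega

theorem step_lt {v i : ℕ} (h : A.Label v i) : A.step v i < i := (isStep_step h).1.2.1

/-- The label of i determines its user, so the choice made in `parent` is immaterial. -/
theorem Uses.parent_eq {v i : ℕ} (h : A.Uses v i) : A.parent i = A.step v i := by
  have hex : ∃ v, A.Uses v i := ⟨v, h⟩
  rw [parent, dif_pos hex, hex.choose_spec.1.unique h.1]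

theorem Uses.parent_lt {v i : ℕ} (h : A.Uses v i) : A.parent i < i := by
  rw [h.parent_eq]
  exact step_lt h.1

theorem chain_used {v : ℕ} (hv : A.Vert v) (m : ℕ) : A.Used (A.chain v m) := by
  induction m with
  | zero => exact A.start_used v hv
  | succ m ih =>
    rw [chain]
    split_ifs with h
    · exact (isStep_step h).1.1
    · exact ih

theorem chain_antitone (v : ℕ) : Antitone (A.chain v) := by
  refine antitone_nat_of_succ_le fun m => ?_
  rw [chain]
  split_ifs with h
  · exact (step_lt h).le
  · exact le_rfl

/-- Indices only decrease along a chain, so no later member lies strictly between i and its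
successor. -/
theorem Uses.le_step {v i j : ℕ} (hi : A.Uses v i) (hj : A.Uses v j) (hlt : j < i) :
    j ≤ A.step v i := by
  obtain ⟨hl, m, rfl⟩ := hi
  obtain ⟨-, m', rfl⟩ := hj
  have hm : m < m' := by
    by_contra! hc
    have := A.chain_antitone v hc
    omega
  have h1 := A.chain_antitone v (Nat.succ_le_of_lt hm)
  rwa [Nat.succ_eq_add_one, chain, if_pos hl] at h1

theorem chain_subset (v m : ℕ) :
    A.lo (A.chain v (m + 1)) ≤ A.lo (A.chain v m) ∧
      A.hi (A.chain v m) ≤ A.hi (A.chain v (m + 1)) := by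
  rw [chain]
  split_ifs with h
  · exact (isStep_step h).1.subset h.2.1
  · exact ⟨le_rfl, le_rfl⟩

theorem mem_chain {v : ℕ} (hv : A.Vert v) (m : ℕ) :
    A.lo (A.chain v m) ≤ v ∧ v ≤ A.hi (A.chain v m) := by
  induction m with
  | zero => exact A.mem_of_isEnd _ _ (A.start_used v hv) (A.start_isEnd v hv)
  | succ m ih =>
    have := chain_subset (A := A) v m
    omega

theorem level_of_parent_lt {i : ℕ} (h : A.parent i < i)
    [Decidable (∃ v, A.Uses v i ∧ A.Uses v (A.parent i))] :
    A.level i = A.level (A.parent i) +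
      if ∃ v, A.Uses v i ∧ A.Uses v (A.parent i) then 0 else 1 := by
  rw [level, dif_pos h]
  congr

/-- Up to a labelled member all members of the chain are labelled, so consecutive ones share the
user v and the level never changes. Hence the arcs used by v are deleted all together or not at all.
-/
theorem Uses.level_eq {v i : ℕ} (h : A.Uses v i) : A.level i = A.level (A.start v) := by
  obtain ⟨hl, m, rfl⟩ := h
  induction m with
  | zero => rfl
  | succ m ih =>
    classical
    by_cases h : A.Label v (A.chain v m)
    · have hu : A.Uses v (A.chain v m) := ⟨h, m, rfl⟩
      have hp : A.parent (A.chain v m) = A.chain v (m + 1) := by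
        rw [hu.parent_eq, chain, if_pos h]
      have := level_of_parent_lt hu.parent_lt
      rw [if_pos ⟨v, hu, by rw [hp]; exact ⟨hl, m + 1, rfl⟩⟩, hp, add_zero] at this
      rw [← this, ih h]
    · rw [chain, if_neg h] at hl
      exact absurd hl h

theorem Kept.parent_lt {q s i : ℕ} (h : A.Kept q s i) : A.parent i < i :=
  h.1.choose_spec.parent_lt

variable (A) in
open Classical in
/-- The root of the component of `i` in the forest of kept arcs. -/
noncomputable def root (q s i : ℕ) : ℕ :=
  if _h : A.Kept q s i then root q s (A.parent i) else i
termination_by i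
decreasing_by exact _h.parent_lt

theorem Kept.root_eq {q s i : ℕ} (h : A.Kept q s i) : A.root q s i = A.root q s (A.parent i) := by
  rw [root, dif_pos h]

theorem root_of_not_kept {q s i : ℕ} (h : ¬ A.Kept q s i) : A.root q s i = i := by
  rw [root, dif_neg h]

theorem root_le (q s i : ℕ) : A.root q s i ≤ i := by
  induction i using Nat.strong_induction_on with
  | _ i ih =>
    by_cases h : A.Kept q s i
    · rw [h.root_eq]
      exact (ih _ h.parent_lt).trans h.parent_lt.le
    · rw [root_of_not_kept h]

/-- The root has the smallest index of its component, so any other member has a kept arc. -/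
theorem kept_of_lt {q s i j : ℕ} (hr : A.root q s j = A.root q s i) (h : j < i) :
    A.Kept q s i := by
  by_contra hc
  have := root_le (A := A) q s j
  rw [hr, root_of_not_kept hc] at this
  omega

theorem Kept.tangled {q s i : ℕ} (h : A.Kept q s i) : A.Used i ∧ A.Tangled i (A.parent i) := by
  obtain ⟨⟨v, hv⟩, -⟩ := h
  rw [hv.parent_eq]
  exact ⟨hv.1.2.1, (isStep_step hv.1).1⟩

/-- Position 0 is a descendant of no vertex, so an interval containing it has no label. -/
theorem not_kept_of_lo_eq_zero {q s i : ℕ} (h : A.lo i = 0) : ¬ A.Kept q s i := by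
  rintro ⟨⟨v, hv⟩, -⟩
  exact A.not_D_zero v hv.1.1 (hv.1.2.2.2.2 0 (by omega) (by omega))

/-- The chain of a vertex whose level is not deleted stays in one component. -/
theorem root_chain {q s v : ℕ} (h : A.level (A.start v) % q ≠ s) (m : ℕ) :
    A.root q s (A.chain v m) = A.root q s (A.start v) := by
  induction m with
  | zero => rfl
  | succ m ih =>
    by_cases hl : A.Label v (A.chain v m)
    · have hu : A.Uses v (A.chain v m) := ⟨hl, m, rfl⟩
      have hk : A.Kept q s (A.chain v m) := ⟨⟨v, hu⟩, by rwa [hu.level_eq]⟩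
      have := hk.root_eq
      rw [← ih, this, hu.parent_eq, chain, if_pos hl]
    · rw [chain, if_neg hl, ih]

/-- The component of the chain of `v` connects `v` to a non-descendant. -/
theorem exists_not_subset {q s v c d : ℕ} (hv : A.Vert v) (h : A.level (A.start v) % q ≠ s)
    (hcv : c ≤ v) (hvd : v ≤ d) (hD : ∀ u, c ≤ u → u ≤ d → A.D v u) :
    ∃ j, A.Used j ∧ A.root q s j = A.root q s (A.start v) ∧
      (∃ p, c ≤ p ∧ p ≤ d ∧ A.IsEnd j p) ∧ ¬ (c ≤ A.lo j ∧ A.hi j ≤ d) := by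
  -- Otherwise the chain stays within [c, d] forever, so v labels all its members and their indices
  -- decrease strictly without end.
  by_contra! hcon
  have hin : ∀ m, c ≤ A.lo (A.chain v m) ∧ A.hi (A.chain v m) ≤ d := by
    intro m
    induction m with
    | zero => exact hcon _ (A.start_used v hv) rfl ⟨v, hcv, hvd, A.start_isEnd v hv⟩
    | succ m ih =>
      by_cases hl : A.Label v (A.chain v m)
      · refine hcon _ (chain_used hv _) (root_chain h _) ?_
        rw [chain, if_pos hl]
        obtain ⟨-, -, p, h1, h2, hp⟩ := (isStep_step hl).1
        exact ⟨p, by omega, by omega, hp⟩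
      · rwa [chain, if_neg hl]
  have hlab : ∀ m, A.Label v (A.chain v m) := fun m =>
    ⟨hv, chain_used hv m, (mem_chain hv m).1, (mem_chain hv m).2, fun u h1 h2 =>
      hD u (by have := hin m; omega) (by have := hin m; omega)⟩
  have hlt : ∀ m, A.chain v m + m ≤ A.start v := by
    intro m
    induction m with
    | zero => exact le_rfl
    | succ m ih =>
      have := step_lt (hlab m)
      rw [chain, if_pos (hlab m)]
      omega
  have := hlt (A.start v + 1)
  omega

/-! ### Few festoons of a component are tangled with a given one. -/

variable (A) in
/-- `j` is reached from `i` by kept arcs. -/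
def Reaches (q s : ℕ) : ℕ → ℕ → Prop :=
  Relation.ReflTransGen fun i j => A.Kept q s i ∧ j = A.parent i

theorem level_parent_le {i : ℕ} (h : A.parent i < i) :
    A.level (A.parent i) ≤ A.level i ∧ A.level i ≤ A.level (A.parent i) + 1 := by
  classical
  rw [level_of_parent_lt h]
  split_ifs <;> omega

theorem Reaches.le {q s i j : ℕ} (h : A.Reaches q s i j) : j ≤ i := by
  induction h using Relation.ReflTransGen.head_induction_on with
  | refl => exact le_rfl
  | head hk _ ih =>
    obtain ⟨hk, rfl⟩ := hk
    exact ih.trans hk.parent_lt.le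

theorem Reaches.level {q s i j : ℕ} (h : A.Reaches q s i j) (hj : A.Kept q s j) :
    A.level j ≤ A.level i ∧ ∀ k, A.level j ≤ k → k ≤ A.level i → k % q ≠ s := by
  induction h using Relation.ReflTransGen.head_induction_on with
  | refl =>
    refine ⟨le_rfl, fun k h1 h2 => ?_⟩
    rw [le_antisymm h2 h1]
    exact hj.2
  | @head i _ hk _ ih =>
    obtain ⟨hk, rfl⟩ := hk
    have := level_parent_le hk.parent_lt
    refine ⟨ih.1.trans this.1, fun k h1 h2 => ?_⟩
    rcases h2.eq_or_lt with rfl | h2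
    · exact hk.2
    · exact ih.2 k h1 (by omega)

/-- A festoon tangled with `x` is reached from each smaller festoon around `x` in its component. -/
theorem reaches_of_tangled {q s x y z : ℕ} (hx : A.Used x) (hz : A.Used z)
    (hxy : y = x ∨ A.Tangled x y)
    (hr : A.root q s z = A.root q s y) (hxz : A.lo z ≤ A.lo x ∧ A.hi x ≤ A.hi z) (hyz : y ≤ z) :
    A.Reaches q s z y := by
  induction z using Nat.strong_induction_on with
  | _ z ih =>
  rcases hyz.eq_or_lt with rfl | hlt
  · exact Relation.ReflTransGen.refl
  have hk : A.Kept q s z := kept_of_lt hr.symm hlt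
  have hzy : A.Tangled z y := by
    rcases hxy with rfl | ⟨h1, h2, p, h3, h4, h5⟩
    · obtain ⟨p, hp⟩ := A.exists_isEnd y hx
      have := A.mem_of_isEnd y p hx hp
      exact ⟨hx, hlt, p, by omega, by omega, hp⟩
    · exact ⟨h1, hlt, p, by omega, by omega, h5⟩
  obtain ⟨v, hv⟩ := hk.1
  have hsub := hk.tangled.2.subset hz
  have hle : y ≤ A.parent z := by
    -- Suppose the arc from z jumps past y. The step prefers the smallest leaving festoon, so y does
    -- not leave the descendants of v, and v labels y. As y is kept, its user must be v, so the
    -- chain of v visits y after z without jumping past it.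
    by_contra! hc
    have hst := isStep_step hv.1
    rw [← hv.parent_eq] at hst
    have hnl : ¬ A.Leaves v y := by
      intro hl
      rcases hst.2 with h | h
      · have := h.2 y hzy hl
        omega
      · exact h.1 y hzy hl
    have hsub' := hzy.subset hz
    have hl : A.Label v y := by
      have := hv.1.2.2.1
      have := hv.1.2.2.2.1
      refine ⟨hv.1.1, hzy.1, by omega, by omega, fun u h1 h2 => ?_⟩
      by_contra hu
      exact hnl ⟨u, h1, h2, hu⟩
    have hky : A.Kept q s y := kept_of_lt (j := A.parent z) (by rw [← hk.root_eq, hr]) hc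
    obtain ⟨w, hw⟩ := hky.1
    obtain rfl := hw.1.unique hl
    have := hv.le_step hw hlt
    rw [← hv.parent_eq] at this
    omega
  exact Relation.ReflTransGen.head ⟨hk, rfl⟩ (ih _ hk.parent_lt hk.tangled.2.1
    (by rw [← hk.root_eq, hr]) (by omega) hle)

/-- Equal levels would mean that the user v of y' also uses its parent. The parent then does not
leave the descendants of v, so it was chosen as the largest festoon tangled with y'. But y'' is also
tangled with y' and is larger than y, while the path from the parent still reaches y. -/
theorem level_lt_of_tangled {q s x y y' y'' : ℕ} (hx : A.Used x)
    (hy : A.Tangled x y) (hy' : y' = x ∨ A.Tangled x y') (hy'' : A.Tangled x y'')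
    (hr : A.root q s y' = A.root q s y) (hr' : A.root q s y = A.root q s y'')
    (h1 : y'' < y) (h2 : y < y') : A.level y < A.level y' := by
  have hu' : A.Used y' := by
    rcases hy' with rfl | h
    · exact hx
    · exact h.1
  have hsub : A.lo y' ≤ A.lo x ∧ A.hi x ≤ A.hi y' := by
    rcases hy' with rfl | h
    · exact ⟨le_rfl, le_rfl⟩
    · exact h.subset hx
  have hky : A.Kept q s y := kept_of_lt hr'.symm h1
  have hreach : A.Reaches q s y' y := reaches_of_tangled hx hu' (Or.inr hy) hr hsub h2.le
  have hle := (hreach.level hky).1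
  refine lt_of_le_of_ne hle fun heq => ?_
  rcases Relation.ReflTransGen.cases_head hreach with h | ⟨_, ⟨hk, rfl⟩, hr'⟩
  · omega
  have hreach' : A.Reaches q s (A.parent y') y := hr'
  classical
  have hl' := (hreach'.level hky).1
  have hl := level_of_parent_lt hk.parent_lt
  have hex : ∃ v, A.Uses v y' ∧ A.Uses v (A.parent y') := by
    by_contra hc
    rw [if_neg hc] at hl
    omega
  obtain ⟨v, hv, hv'⟩ := hex
  have hst := isStep_step hv.1
  rw [← hv.parent_eq] at hst
  rcases hst.2 with h | h
  · obtain ⟨u, hu1, hu2, hu⟩ := h.1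
    exact hu (hv'.1.2.2.2.2 u hu1 hu2)
  · obtain ⟨a1, a2, p, a3, a4, a5⟩ := hy''
    have := h.2 y'' ⟨a1, by omega, p, by omega, by omega, a5⟩
    have := hreach'.le
    omega

/-- The festoons of one component that are tangled with a fixed festoon number at most `q`. -/
theorem card_tangled_le {q s x : ℕ} (hs : s < q) (hx : A.Used x) (Q : Finset ℕ)
    (hQ : ∀ y ∈ Q, (y = x ∨ A.Tangled x y) ∧ A.root q s y = A.root q s x) : Q.card ≤ q := by
  rcases Q.eq_empty_or_nonempty with rfl | hne
  · simp
  -- The smallest index m is counted separately: it may be a root, and it plays the role of y'' in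
  -- `level_lt_of_tangled`. The remaining levels are distinct and take at most q - 1 values.
  set m := Q.min' hne with hm
  have hmQ : m ∈ Q := Q.min'_mem hne
  rcases (Q.erase m).eq_empty_or_nonempty with he | hne'
  · have := Finset.card_erase_add_one hmQ
    rw [he, Finset.card_empty] at this
    omega
  set n := (Q.erase m).min' hne' with hn
  have hnQ : n ∈ Q.erase m := (Q.erase m).min'_mem hne'
  have hlt : ∀ y ∈ Q.erase m, m < y := by
    intro y hy
    obtain ⟨h1, h2⟩ := Finset.mem_erase.1 hy
    exact lt_of_le_of_ne (Q.min'_le y h2) (Ne.symm h1)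
  have hxm : ∀ y ∈ Q, y ≤ x := by
    intro y hy
    rcases (hQ y hy).1 with h | h
    · exact h.le
    · exact h.2.1.le
  have htan : ∀ y ∈ Q, y < x → A.Tangled x y := by
    intro y hy hyx
    rcases (hQ y hy).1 with h | h
    · omega
    · exact h
  have hroot : ∀ y ∈ Q, ∀ z ∈ Q, A.root q s y = A.root q s z := fun y hy z hz =>
    (hQ y hy).2.trans (hQ z hz).2.symm
  have hkn : A.Kept q s n :=
    kept_of_lt (hroot m hmQ n (Finset.mem_erase.1 hnQ).2) (hlt n hnQ)
  have hmono : ∀ y ∈ Q.erase m, ∀ z ∈ Q.erase m, y < z → A.level y < A.level z := by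
    intro y hy z hz hyz
    have hyQ := (Finset.mem_erase.1 hy).2
    have hzQ := (Finset.mem_erase.1 hz).2
    have := hxm z hzQ
    have hmy := hlt y hy
    exact level_lt_of_tangled hx (htan y hyQ (by omega)) (hQ z hzQ).1 (htan m hmQ (by omega))
      (hroot z hzQ y hyQ) (hroot y hyQ m hmQ) hmy hyz
  have himg : ∀ y ∈ Q.erase m, A.level y ∈ Finset.Ico (A.level n) (A.level n + (q - 1)) := by
    intro y hy
    have hyQ := (Finset.mem_erase.1 hy).2
    have hnQ' := (Finset.mem_erase.1 hnQ).2
    have hu : A.Used y ∧ A.lo y ≤ A.lo x ∧ A.hi x ≤ A.hi y := by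
      rcases (hQ y hyQ).1 with rfl | h
      · exact ⟨hx, le_rfl, le_rfl⟩
      · exact ⟨h.1, h.subset hx⟩
    have hreach : A.Reaches q s y n := reaches_of_tangled hx hu.1 (hQ n hnQ').1
      (hroot y hyQ n hnQ') hu.2 ((Q.erase m).min'_le y hy)
    obtain ⟨h1, h2⟩ := hreach.level hkn
    rw [Finset.mem_Ico]
    refine ⟨h1, ?_⟩
    -- Otherwise the range from the level of n to that of y contains q consecutive levels, one of
    -- them congruent to s, which the kept path from y to n excludes. The witness is the first such
    -- level from that of n upwards.
    by_contra! hc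
    have hmod : A.level n % q < q := Nat.mod_lt _ (by omega)
    by_cases hle : A.level n % q ≤ s
    · refine h2 (A.level n + (s - A.level n % q)) (by omega) (by omega) ?_
      have : A.level n + (s - A.level n % q) = s + q * (A.level n / q) := by
        have := Nat.mod_add_div (A.level n) q
        omega
      rw [this, Nat.add_mul_mod_self_left, Nat.mod_eq_of_lt hs]
    · refine h2 (A.level n + (s + q - A.level n % q)) (by omega) (by omega) ?_
      have : A.level n + (s + q - A.level n % q) = s + q * (A.level n / q + 1) := by
        have := Nat.mod_add_div (A.level n) q
        rw [mul_add]
        omega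
      rw [this, Nat.add_mul_mod_self_left, Nat.mod_eq_of_lt hs]
  have hinj : Set.InjOn A.level (Q.erase m : Finset ℕ) := by
    intro y hy z hz hyz
    by_contra hne
    rcases lt_or_gt_of_ne hne with h | h
    · have := hmono y hy z hz h
      omega
    · have := hmono z hz y hy h
      omega
  have := Finset.card_le_card_of_injOn A.level himg hinj
  have := Finset.card_erase_add_one hmQ
  rw [Nat.card_Ico] at *
  omega

/-! ### Intervals compatible with a component. -/

variable (A) in
/-- The interval `[c, d]` is laminar with all festoon intervals of the component `ρ` that do not
contain the position `0`. -/
def Compatible (q s ρ c d : ℕ) : Prop :=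
  ∀ i, A.Used i → A.root q s i = ρ → A.lo i = 0 ∨ (c ≤ A.lo i ∧ A.hi i ≤ d) ∨
    (A.hi i < c ∨ d < A.lo i) ∨ (A.lo i ≤ c ∧ d ≤ A.hi i)

/-- Let x be the smallest festoon in Q. If its interval contains 0, then x is the root and Q has no
other member. Otherwise compatibility forces its interval to contain [c, d], so every other member
of Q is tangled with x and `card_tangled_le` applies. -/
theorem card_crossing_le {q s ρ c d : ℕ} (hs : s < q) (hG : A.Compatible q s ρ c d)
    (Q : Finset ℕ) (hQ : ∀ i ∈ Q, A.Used i ∧ A.root q s i = ρ ∧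
      (∃ p, c ≤ p ∧ p ≤ d ∧ A.IsEnd i p) ∧ ∃ p, (p < c ∨ d < p) ∧ A.IsEnd i p) : Q.card ≤ q := by
  rcases Q.eq_empty_or_nonempty with rfl | hne
  · simp
  have hxQ := Q.max'_mem hne
  have hmax : ∀ y ∈ Q, y ≤ Q.max' hne := fun y hy => Q.le_max' y hy
  generalize Q.max' hne = x at hxQ hmax
  obtain ⟨hu, hr, ⟨p, hp1, hp2, hp⟩, p', hp', hpe⟩ := hQ x hxQ
  have hpm := A.mem_of_isEnd x p hu hp
  have hpm' := A.mem_of_isEnd x p' hu hpe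
  refine card_tangled_le hs hu Q fun y hy => ⟨?_, (hQ y hy).2.1.trans hr.symm⟩
  have hyx : y ≤ x := hmax y hy
  rcases hyx.eq_or_lt with rfl | hlt
  · exact Or.inl rfl
  obtain ⟨huy, hry, ⟨p₁, h1, h2, h3⟩, -⟩ := hQ y hy
  rcases hG x hu hr with h | h | h | h
  · have := root_le (A := A) q s y
    rw [hry, ← hr, root_of_not_kept (not_kept_of_lo_eq_zero h)] at this
    omega
  · omega
  · omega
  · exact Or.inr ⟨huy, hlt, p₁, by omega, by omega, h3⟩

theorem compatible_univ {N : ℕ} (hN : ∀ i, A.Used i → A.hi i ≤ N) (q s ρ : ℕ) :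
    A.Compatible q s ρ 1 N := by
  intro i hi _
  have := hN i hi
  omega

/-- Compatible intervals can be split into compatible intervals. -/
theorem Compatible.exists_split {q s ρ c d : ℕ} (h : A.Compatible q s ρ c d) (hcd : c < d) :
    ∃ m, c ≤ m ∧ m < d ∧ A.Compatible q s ρ c m ∧ A.Compatible q s ρ (m + 1) d := by
  classical
  -- Cut behind the largest component interval that starts at c and ends before d, found as the one
  -- of smallest index. If there is none, splitting off the single position c cuts no interval
  -- badly.
  by_cases hex : ∃ i, A.Used i ∧ A.root q s i = ρ ∧ A.lo i = c ∧ c ≤ A.hi i ∧ A.hi i < d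
  · obtain ⟨hu, hr, h1, h2, h3⟩ := Nat.find_spec hex
    have hmin := fun k => Nat.find_min hex (m := k)
    generalize Nat.find hex = i at hu hr h1 h2 h3 hmin
    have hlam : ∀ j, A.Used j → A.root q s j = ρ → A.hi j < A.lo i ∨ A.hi i < A.lo j ∨
        (A.lo i ≤ A.lo j ∧ A.hi j ≤ A.hi i) ∨ (A.lo j ≤ A.lo i ∧ A.hi i ≤ A.hi j ∧
          (c ≤ A.hi j → A.hi j < d → A.lo j < c)) := by
      intro j huj hrj
      rcases lt_trichotomy i j with hij | rfl | hij
      · have := A.laminar i j hu huj hij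
        omega
      · omega
      · have := A.laminar j i huj hu hij
        have := hmin j hij
        by_cases hc : A.lo j = c ∧ c ≤ A.hi j ∧ A.hi j < d
        · exact absurd ⟨huj, hrj, hc⟩ this
        · omega
    refine ⟨A.hi i, h2, h3, fun j huj hrj => ?_, fun j huj hrj => ?_⟩
    · have := h j huj hrj
      have := hlam j huj hrj
      omega
    · have := h j huj hrj
      have := hlam j huj hrj
      omega
  · refine ⟨c, le_rfl, hcd, fun j huj hrj => ?_, fun j huj hrj => ?_⟩
    · omega
    · have := h j huj hrj
      by_cases hc : A.lo j = c ∧ c ≤ A.hi j ∧ A.hi j < d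
      · exact absurd ⟨j, huj, hrj, hc⟩ hex
      · omega

end FestoonSystem

/-! ### The combinatorial core on the line. -/

open Classical in
/-- The combinatorial core of the decomposition theorem: links on the line `0, …, N`, where `D v`
is the set of descendants of `v`. For each residue class `s` of levels modulo `q`, the links are
partitioned into classes such that every vertex outside the residue class has a class covering
all its intervals of descendants, and each class has few links crossing the members of a
hierarchy of intervals. -/
theorem exists_level_and_classes {ι : Type*} (N : ℕ) (lt rt : ι → ℕ) (S : Finset ι)
    (hlt : ∀ x ∈ S, lt x < rt x) (hN : ∀ x ∈ S, rt x ≤ N)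
    (hcov : ∀ c d, 1 ≤ c → c ≤ d → d ≤ N → ∃ x ∈ S, LinkCrosses lt rt c d x)
    (D : ℕ → ℕ → Prop)
    (hD : ∀ v w, 1 ≤ v → v ≤ N → 1 ≤ w → w ≤ N → D v w → D w v → v = w)
    (hD0 : ∀ v, 1 ≤ v → v ≤ N → ¬ D v 0) (q : ℕ) :
    ∃ level : ℕ → ℕ, ∀ s < q, ∃ cls : ι → ℕ,
      (∀ v, 1 ≤ v → v ≤ N → level v % q ≠ s → ∃ x ∈ S, ∀ c d, c ≤ v → v ≤ d →
        (∀ u, c ≤ u → u ≤ d → D v u) → ∃ y ∈ S, cls y = cls x ∧ LinkCrosses lt rt c d y) ∧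
      ∀ ρ : ℕ, ∃ P : ℕ → ℕ → Prop, P 1 N ∧
        (∀ c d, P c d → c < d → ∃ m, c ≤ m ∧ m < d ∧ P c m ∧ P (m + 1) d) ∧
        ∀ c d, P c d →
          (S.filter fun y => cls y = ρ ∧ LinkCrosses lt rt c d y).card ≤ 4 * q := by
  obtain ⟨g, lo, hi, hfest, hlam⟩ := exists_festoon_partition lt rt S hlt
  have hmem : ∀ x ∈ S, lo (g x) ≤ lt x ∧ rt x ≤ hi (g x) := fun x hx =>
    (hfest x hx).mem x (Finset.mem_filter.2 ⟨hx, rfl⟩)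
  have hhi : ∀ x ∈ S, hi (g x) ≤ N := by
    intro x hx
    have hb := (hfest x hx).bounds_lt
    obtain ⟨z, hz, h1, h2⟩ := (hfest x hx).cover (hi (g x) - 1) (by omega) (by omega)
    have := hN z (Finset.mem_filter.1 hz).1
    omega
  have hstart : ∀ v, ∃ i, 1 ≤ v ∧ v ≤ N →
      (∃ x ∈ S, g x = i) ∧ ∃ x ∈ S, g x = i ∧ (v = lt x ∨ v = rt x) := by
    intro v
    by_cases hv : 1 ≤ v ∧ v ≤ N
    -- A link crossing the singleton cut {v} ends at v.
    · obtain ⟨x, hx, hc⟩ := hcov v v hv.1 le_rfl hv.2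
      refine ⟨g x, fun _ => ⟨⟨x, hx, rfl⟩, x, hx, rfl, ?_⟩⟩
      unfold LinkCrosses at hc
      omega
    · exact ⟨0, fun h => absurd h hv⟩
  choose start hstart using hstart
  let A : FestoonSystem :=
    { Used := fun i => ∃ x ∈ S, g x = i
      lo := lo
      hi := hi
      IsEnd := fun i p => ∃ x ∈ S, g x = i ∧ (p = lt x ∨ p = rt x)
      mem_of_isEnd := by
        rintro i p - ⟨x, hx, rfl, hp⟩
        have := hmem x hx
        have := hlt x hx
        omega
      exists_isEnd := by
        rintro i ⟨x, hx, rfl⟩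
        exact ⟨lt x, x, hx, rfl, Or.inl rfl⟩
      laminar := by
        rintro i j ⟨x, hx, rfl⟩ ⟨y, hy, rfl⟩ h
        exact hlam x hx y hy h
      Vert := fun v => 1 ≤ v ∧ v ≤ N
      D := D
      D_antisymm := fun v w hv hw => hD v w hv.1 hv.2 hw.1 hw.2
      not_D_zero := fun v hv => hD0 v hv.1 hv.2
      start := start
      start_used := fun v hv => (hstart v hv).1
      start_isEnd := fun v hv => (hstart v hv).2
      progress := by
        rintro i ⟨x, hx, rfl⟩ h0
        have hb := (hfest x hx).bounds_lt
        -- A link crossing the interval of a festoon belongs to another festoon, and by laminarity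
        -- to one of smaller index.
        obtain ⟨y, hy, hc⟩ := hcov (lo (g x)) (hi (g x)) (by omega) hb.le (hhi x hx)
        have hym := hmem y hy
        have hyl := hlt y hy
        unfold LinkCrosses at hc
        refine ⟨g y, ⟨y, hy, rfl⟩, ?_, ?_⟩
        · rcases lt_trichotomy (g y) (g x) with h | h | h
          · exact h
          · rw [h] at hym
            omega
          · have := hlam x hx y hy h
            omega
        · rcases hc with hc | hc
          · exact ⟨rt y, by omega, by omega, y, hy, rfl, Or.inr rfl⟩
          · exact ⟨lt y, by omega, by omega, y, hy, rfl, Or.inl rfl⟩ }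
  refine ⟨fun v => A.level (start v), fun s hs => ⟨fun x => A.root q s (g x), ?_, ?_⟩⟩
  · intro v hv1 hvN hl
    obtain ⟨⟨x, hx, hgx⟩, -⟩ := hstart v ⟨hv1, hvN⟩
    refine ⟨x, hx, fun c d hcv hvd hDv => ?_⟩
    obtain ⟨j, ⟨z, hz, rfl⟩, hroot, ⟨p, hp1, hp2, y, hy, hgy, hpy⟩, hsub⟩ :=
      A.exists_not_subset (c := c) (d := d) (v := v) ⟨hv1, hvN⟩ hl hcv hvd hDv
    have hr : A.root q s (g z) = A.root q s (g x) := hroot.trans (by rw [hgx])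
    -- A festoon with an end in [c, d] and no crossing link would lie inside [c, d].
    by_contra! hcon
    refine hsub ((hfest z hz).subset_of_not_crosses (c := c) (d := d) (x := y) ?_
      (Finset.mem_filter.2 ⟨hy, hgy⟩) (by omega))
    intro w hw
    obtain ⟨hw, hgw⟩ := Finset.mem_filter.1 hw
    exact hcon w hw (by simp only [hgw, hr])
  · intro ρ
    refine ⟨A.Compatible q s ρ, A.compatible_univ ?_ q s ρ, fun c d h hcd => h.exists_split hcd,
      fun c d h => ?_⟩
    · rintro i ⟨x, hx, rfl⟩
      exact hhi x hx
    · set T := S.filter fun y => A.root q s (g y) = ρ ∧ LinkCrosses lt rt c d y with hT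
      have hcard : (T.image g).card ≤ q := by
        refine FestoonSystem.card_crossing_le hs h _ fun i hi => ?_
        obtain ⟨y, hy, rfl⟩ := Finset.mem_image.1 hi
        obtain ⟨hy, hr, hc⟩ := Finset.mem_filter.1 hy
        refine ⟨⟨y, hy, rfl⟩, hr, ?_⟩
        have := hlt y hy
        unfold LinkCrosses at hc
        rcases hc with hc | hc
        · exact ⟨⟨rt y, by omega, by omega, y, hy, rfl, Or.inr rfl⟩,
            lt y, by omega, y, hy, rfl, Or.inl rfl⟩
        · exact ⟨⟨lt y, by omega, by omega, y, hy, rfl, Or.inl rfl⟩,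
            rt y, by omega, y, hy, rfl, Or.inr rfl⟩
      refine (Finset.card_le_mul_card_image T 4 fun i hi => ?_).trans (by gcongr)
      obtain ⟨y, hy, rfl⟩ := Finset.mem_image.1 hi
      refine (Finset.card_le_card ?_).trans
        ((hfest y (Finset.mem_filter.1 hy).1).card_crosses_le c d)
      intro x hx
      obtain ⟨hx, hgx⟩ := Finset.mem_filter.1 hx
      obtain ⟨hx, hr, hc⟩ := Finset.mem_filter.1 hx
      exact Finset.mem_filter.2 ⟨Finset.mem_filter.2 ⟨hx, hgx⟩, hc⟩

/-! ### Arborescences from directed covers of intervals. -/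

open Classical in
/-- If directed links cover all intervals in `1, …, N`, then some of their shortenings form an
arborescence rooted at `0`. -/
theorem exists_shortened_arborescence (N : ℕ) (F : ℕ → ℕ → Prop)
    (hF : ∀ c d, 1 ≤ c → c ≤ d → d ≤ N → ∃ u v, F u v ∧ u ≤ N ∧ (u < c ∨ d < u) ∧ c ≤ v ∧ v ≤ d) :
    ∃ par t : ℕ → ℕ, par 0 = 0 ∧ ∀ v, 1 ≤ v → v ≤ N → t (par v) < t v ∧ par v ≤ N ∧
      ∃ u, F u v ∧ u ≤ N ∧ ((u ≤ par v ∧ par v < v) ∨ (v < par v ∧ par v ≤ u)) := by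
  have key : ∀ k ≤ N, ∃ W ⊆ Finset.range (N + 1), 0 ∈ W ∧ W.card = k + 1 ∧
      ∃ par t : ℕ → ℕ, par 0 = 0 ∧ ∀ w ∈ W, t w ≤ k ∧ (1 ≤ w → par w ∈ W ∧ t (par w) < t w ∧
        ∃ u, F u w ∧ u ≤ N ∧ ((u ≤ par w ∧ par w < w) ∨ (w < par w ∧ par w ≤ u))) := by
    intro k
    induction k with
    | zero =>
      intro _
      exact ⟨{0}, by simp, by simp, by simp, fun _ => 0, fun _ => 0, rfl, by simp⟩
    | succ k ih =>
      intro hk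
      obtain ⟨W, hWN, h0, hcard, par, t, hpar0, hW⟩ := ih (by omega)
      have hex : ∃ v ∈ Finset.range (N + 1), v ∉ W :=
        Finset.exists_mem_notMem_of_card_lt_card (by rw [hcard, Finset.card_range]; omega)
      obtain ⟨v, hv, hvW⟩ := hex
      have hvN : v ≤ N := by simpa [Nat.lt_succ_iff] using hv
      -- The positions a + 1, …, d form the maximal interval around v that avoids the set W reached
      -- so far.
      have hc1 := Nat.findGreatest_spec (P := (· ∈ W)) (n := v) (Nat.zero_le v) h0
      have hc2 := fun k => Nat.findGreatest_is_greatest (P := (· ∈ W)) (n := v) (k := k)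
      have hc3 := Nat.findGreatest_le (P := (· ∈ W)) v
      generalize Nat.findGreatest (· ∈ W) v = a at hc1 hc2 hc3
      have hav : a ≠ v := fun h => hvW (h ▸ hc1)
      have hd1 := Nat.findGreatest_spec (P := fun d => ∀ x, v ≤ x → x ≤ d → x ∉ W) (n := N) hvN
        (fun x h1 h2 => by rwa [le_antisymm h2 h1])
      have hd2 := fun k => Nat.findGreatest_is_greatest
        (P := fun d => ∀ x, v ≤ x → x ≤ d → x ∉ W) (n := N) (k := k)
      have hd3 := Nat.findGreatest_le (P := fun d => ∀ x, v ≤ x → x ≤ d → x ∉ W) N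
      have hd4 := Nat.le_findGreatest (P := fun d => ∀ x, v ≤ x → x ≤ d → x ∉ W) (n := N) hvN
        (fun x h1 h2 => by rwa [le_antisymm h2 h1])
      generalize Nat.findGreatest (fun d => ∀ x, v ≤ x → x ≤ d → x ∉ W) N = d at hd1 hd2 hd3 hd4
      have hdW : d < N → d + 1 ∈ W := by
        intro h
        have := hd2 (d + 1) (by omega) (by omega)
        push Not at this
        obtain ⟨x, h1, h2, h3⟩ := this
        by_cases hx : x ≤ d
        · exact absurd h3 (hd1 x h1 hx)
        · rwa [show d + 1 = x by omega]
      have hout : ∀ x, a + 1 ≤ x → x ≤ d → x ∉ W := by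
        intro x h1 h2
        by_cases hx : v ≤ x
        · exact hd1 x hx h2
        · exact hc2 x (by omega) (by omega)
      obtain ⟨u, w, hFu, huN, hu, hw1, hw2⟩ := hF (a + 1) d (by omega) (by omega) hd3
      have hwW := hout w hw1 hw2
      -- The link enters that interval from one side, hence passes over the member of W bordering it
      -- there, which becomes the new tail. On the right, u ≤ N guarantees that d + 1 exists.
      obtain ⟨s, hsW, hs⟩ : ∃ s ∈ W, (u ≤ s ∧ s < w) ∨ (w < s ∧ s ≤ u) := by
        rcases hu with h | h
        · exact ⟨a, hc1, by omega⟩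
        · exact ⟨d + 1, hdW (by omega), by omega⟩
      refine ⟨insert w W, ?_, Finset.mem_insert_of_mem h0, ?_, Function.update par w s,
        Function.update t w (k + 1), ?_, ?_⟩
      · intro x hx
        rcases Finset.mem_insert.1 hx with rfl | hx
        · rw [Finset.mem_range]
          omega
        · exact hWN hx
      · rw [Finset.card_insert_of_notMem hwW, hcard]
      · rw [Function.update_of_ne (by omega), hpar0]
      · have hne : ∀ x ∈ W, x ≠ w := fun x hx h => hwW (h ▸ hx)
        intro x hx
        rcases Finset.mem_insert.1 hx with rfl | hx
        · have := (hW s hsW).1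
          simp only [Function.update_self, Function.update_of_ne (hne s hsW)]
          exact ⟨le_rfl, fun _ => ⟨Finset.mem_insert_of_mem hsW, by omega, u, hFu, huN, hs⟩⟩
        · simp only [Function.update_of_ne (hne x hx)]
          refine ⟨by have := (hW x hx).1; omega, fun h => ?_⟩
          obtain ⟨h1, h2, h3⟩ := (hW x hx).2 h
          rw [Function.update_of_ne (hne _ h1)]
          exact ⟨Finset.mem_insert_of_mem h1, h2, h3⟩
  obtain ⟨W, hWN, h0, hcard, par, t, hpar0, hW⟩ := key N le_rfl
  have hWeq : W = Finset.range (N + 1) :=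
    Finset.eq_of_subset_of_card_le hWN (by rw [hcard, Finset.card_range])
  subst hWeq
  refine ⟨par, t, hpar0, fun v h1 h2 => ?_⟩
  obtain ⟨h3, h4, h5⟩ := (hW v (by simpa [Nat.lt_succ_iff] using h2)).2 h1
  exact ⟨h4, by simpa [Nat.lt_succ_iff] using h3, h5⟩

/-! ### Ancestors and the descendant relation. -/

/-- `a` is an ancestor of `x` (possibly `x` itself) in the forest with parent function `par`. -/
def IsAncestor (par : ℕ → ℕ) (a x : ℕ) : Prop := ∃ k, par^[k] x = a

/-- No proper ancestor of `v` lies between `v` and `u`. -/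
def NoAncestorBetween (par : ℕ → ℕ) (v u : ℕ) : Prop :=
  ∀ a, IsAncestor par a (par v) → ¬ (v ≤ a ∧ a ≤ u) ∧ ¬ (u ≤ a ∧ a ≤ v)

section Ancestors

variable {N : ℕ} {par t : ℕ → ℕ}

theorem IsAncestor.of_par {a x : ℕ} (h : IsAncestor par a (par x)) : IsAncestor par a x := by
  obtain ⟨k, hk⟩ := h
  exact ⟨k + 1, by rwa [Function.iterate_succ_apply]⟩

theorem IsAncestor.par_of_ne {a x : ℕ} (h : IsAncestor par a x) (hne : x ≠ a) :
    IsAncestor par a (par x) := by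
  obtain ⟨_ | k, hk⟩ := h
  · exact absurd hk hne
  · exact ⟨k, by rwa [Function.iterate_succ_apply] at hk⟩

theorem IsAncestor.le_and_time_le (hpar0 : par 0 = 0)
    (hpar : ∀ v, 1 ≤ v → v ≤ N → t (par v) < t v ∧ par v ≤ N)
    {a x : ℕ} (h : IsAncestor par a x) (hx : x ≤ N) :
    a ≤ N ∧ t a ≤ t x := by
  obtain ⟨k, rfl⟩ := h
  induction k with
  | zero => exact ⟨hx, le_rfl⟩
  | succ k ih =>
    rw [Function.iterate_succ_apply']
    rcases Nat.eq_zero_or_pos (par^[k] x) with h | h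
    · rw [h, hpar0, ← h]
      exact ih
    · have := hpar _ h ih.1
      omega

theorem isAncestor_zero (hpar : ∀ v, 1 ≤ v → v ≤ N → t (par v) < t v ∧ par v ≤ N)
    {x : ℕ} (hx : x ≤ N) : IsAncestor par 0 x := by
  induction h : t x using Nat.strong_induction_on generalizing x with
  | _ n ih =>
  rcases Nat.eq_zero_or_pos x with rfl | h0
  · exact ⟨0, rfl⟩
  · have := hpar x h0 hx
    exact (ih _ (h ▸ this.1) this.2 rfl).of_par

/-- A path to an ancestor `z` leaving `P` has a step leaving `P`. -/
theorem IsAncestor.exists_step (hpar0 : par 0 = 0)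
    (hpar : ∀ v, 1 ≤ v → v ≤ N → t (par v) < t v ∧ par v ≤ N)
    {z x : ℕ} (h : IsAncestor par z x) (P : ℕ → Prop) (hx : P x)
    (hz : ¬ P z) (hxN : x ≤ N) :
    ∃ y, IsAncestor par y x ∧ y ≤ N ∧ P y ∧ ¬ P (par y) ∧ IsAncestor par z (par y) := by
  obtain ⟨k, hk⟩ := h
  induction k generalizing x with
  | zero => exact absurd (hk ▸ hx) hz
  | succ k ih =>
    rw [Function.iterate_succ_apply] at hk
    by_cases hp : P (par x)
    · have hN : par x ≤ N :=
        (IsAncestor.le_and_time_le hpar0 hpar (a := par x) (x := x) ⟨1, rfl⟩ hxN).1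
      obtain ⟨y, h1, h2⟩ := ih hp hN hk
      exact ⟨y, h1.of_par, h2⟩
    · exact ⟨x, ⟨0, rfl⟩, hxN, hx, hp, k, hk⟩

/-- For v < w, every common ancestor lies outside [v, w]. From one on the left, the path to w must
jump over v by a link with head y ≥ w; by `hns`, y is then also an ancestor of v, and a strictly
later common ancestor. The right side is symmetric. Starting from 0 this ascends forever, although
times are bounded by that of v. -/
theorem noAncestorBetween_antisymm (hpar0 : par 0 = 0)
    (hpar : ∀ v, 1 ≤ v → v ≤ N → t (par v) < t v ∧ par v ≤ N)
    (hns : ∀ v s, 1 ≤ v → v ≤ N → (par v < s ∧ s < v) ∨ (v < s ∧ s < par v) →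
      IsAncestor par v s) {v w : ℕ} (hv : v ≤ N) (hw : w ≤ N)
    (hvw : NoAncestorBetween par v w) (hwv : NoAncestorBetween par w v) : v = w := by
  wlog hlt : v < w generalizing v w
  · by_contra hne
    exact hne (this hw hv hwv hvw (by omega)).symm
  exfalso
  have hcommon : ∀ z, IsAncestor par z v → IsAncestor par z w → z < v ∨ w < z := by
    intro z hzv hzw
    by_contra! hc
    by_cases h : v = z
    · subst h
      have := hwv _ (hzw.par_of_ne (by omega))
      omega
    · have := hvw z (hzv.par_of_ne h)
      omega
  have hdesc : ∀ n z, IsAncestor par z v → IsAncestor par z w → t v - t z = n → False := by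
    intro n
    induction n using Nat.strong_induction_on with
    | _ n ih =>
    intro z hzv hzw hn
    have hstep : ∃ y, IsAncestor par y v ∧ IsAncestor par y w ∧ IsAncestor par z (par y) ∧
        1 ≤ y ∧ y ≤ N := by
      rcases hcommon z hzv hzw with hz | hz
      · obtain ⟨y, h1, hyN, h2, h3, h4⟩ :=
          IsAncestor.exists_step hpar0 hpar hzw (fun x => w ≤ x) le_rfl (by omega) hw
        have hp : par y < v := by
          have : IsAncestor par (par y) (par w) := by
            obtain ⟨k, rfl⟩ := h1
            exact ⟨k, by rw [← Function.iterate_succ_apply, Function.iterate_succ_apply']⟩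
          have := hwv _ this
          omega
        exact ⟨y, hns y v (by omega) hyN (by omega), h1, h4, by omega, hyN⟩
      · obtain ⟨y, h1, hyN, h2, h3, h4⟩ :=
          IsAncestor.exists_step hpar0 hpar hzv (fun x => x ≤ v) le_rfl (by omega) hv
        have hp : w < par y := by
          have : IsAncestor par (par y) (par v) := by
            obtain ⟨k, rfl⟩ := h1
            exact ⟨k, by rw [← Function.iterate_succ_apply, Function.iterate_succ_apply']⟩
          have := hvw _ this
          omega
        have hy0 : 1 ≤ y := by
          by_contra hc
          rw [show y = 0 by omega, hpar0] at hp
          omega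
        exact ⟨y, h1, hns y w hy0 hyN (by omega), h4, hy0, hyN⟩
    obtain ⟨y, hyv, hyw, hzy, hy0, hyN⟩ := hstep
    have h1 := hpar y hy0 hyN
    have h2 := (IsAncestor.le_and_time_le hpar0 hpar hzy h1.2).2
    have h3 := (IsAncestor.le_and_time_le hpar0 hpar hyv hv).2
    exact ih (t v - t y) (by omega) y hyv hyw rfl
  exact hdesc _ 0 (isAncestor_zero hpar hv) (isAncestor_zero hpar hw) rfl

theorem not_noAncestorBetween_zero
    (hpar : ∀ v, 1 ≤ v → v ≤ N → t (par v) < t v ∧ par v ≤ N)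
    {v : ℕ} (h1 : 1 ≤ v) (hv : v ≤ N) :
    ¬ NoAncestorBetween par v 0 := fun h =>
  (h 0 (isAncestor_zero hpar (hpar v h1 hv).2)).2 ⟨le_rfl, Nat.zero_le v⟩

end Ancestors

/-! ### Numbering the ring; 2-cuts as intervals. -/

namespace RootedWRAP

variable {V E : Type*}

/-- A numbering of the vertices by `0, …, N` along the path `(V, E ∖ {e_r})`, starting from the
root. -/
structure RingNumbering (I : RootedWRAP V E) (N : ℕ) where
  pos : V → ℕ
  vtx : ℕ → V
  edge : ℕ → E
  one_le : 1 ≤ N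
  pos_le : ∀ x, pos x ≤ N
  vtx_pos : ∀ x, vtx (pos x) = x
  pos_vtx : ∀ k ≤ N, pos (vtx k) = k
  pos_root : pos I.r = 0
  edge_inj : ∀ j ≤ N, ∀ k ≤ N, edge j = edge k → j = k
  edge_surj : ∀ e, ∃ k ≤ N, edge k = e
  ends_edge : ∀ k < N, I.ends (edge k) = s(vtx k, vtx (k + 1))
  ends_last : I.ends (edge N) = s(vtx N, vtx 0)
  edge_last : edge N = I.e_r

/-- The edge `e_r` may leave the root in either direction of the given cyclic order: a rotation
suffices in one case, a reflection is needed in the other. -/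
theorem exists_cyclic_numbering (I : RootedWRAP V E) :
    ∃ (N : ℕ) (_ : 1 ≤ N) (φ : ZMod (N + 1) ≃ V) (ψ : ZMod (N + 1) ≃ E),
      φ 0 = I.r ∧ ψ (-1) = I.e_r ∧ ∀ i, I.ends (ψ i) = s(φ i, φ (i + 1)) := by
  obtain ⟨n, hn, φ, ψ, h⟩ := I.isCycle
  obtain ⟨N, rfl⟩ : ∃ N, n = N + 1 := ⟨n - 1, by omega⟩
  refine ⟨N, by omega, ?_⟩
  obtain ⟨j, hj⟩ := ψ.surjective I.e_r
  have hr := I.r_mem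
  rw [← hj, h, Sym2.mem_iff] at hr
  rcases hr with hr | hr
  · refine ⟨(Equiv.subLeft j).trans φ, (Equiv.subLeft (j - 1)).trans ψ, ?_, ?_, fun i => ?_⟩
    · simp [hr]
    · simp [hj]
    · simp only [Equiv.trans_apply, Equiv.subLeft_apply, h]
      rw [Sym2.eq_swap]
      rw [show j - 1 - i + 1 = j - i by ring, show j - (i + 1) = j - 1 - i by ring]
  · refine ⟨(Equiv.addRight (j + 1)).trans φ, (Equiv.addRight (j + 1)).trans ψ, ?_, ?_,
      fun i => ?_⟩
    · simp [hr]
    · simp [hj]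
    · simp only [Equiv.trans_apply, Equiv.coe_addRight, h]
      rw [show i + (j + 1) + 1 = i + 1 + (j + 1) by ring]

theorem exists_ringNumbering (I : RootedWRAP V E) : ∃ N, Nonempty (I.RingNumbering N) := by
  obtain ⟨N, hN, φ, ψ, h0, h1, h⟩ := I.exists_cyclic_numbering
  refine ⟨N, ⟨⟨fun x => (φ.symm x).val, fun k => φ k, fun k => ψ k, hN, ?_, ?_, ?_, ?_, ?_, ?_, ?_,
    ?_, ?_⟩⟩⟩
  · intro x
    exact Nat.lt_succ_iff.1 (ZMod.val_lt _)
  · intro x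
    simp
  · intro k hk
    simp only [Equiv.symm_apply_apply]
    exact ZMod.val_natCast_of_lt (by omega)
  · simp [← h0]
  · intro j hj k hk hjk
    have := congrArg ZMod.val (ψ.injective hjk)
    rwa [ZMod.val_natCast_of_lt (by omega), ZMod.val_natCast_of_lt (by omega)] at this
  · intro e
    exact ⟨(ψ.symm e).val, Nat.lt_succ_iff.1 (ZMod.val_lt _), by simp⟩
  · intro k _
    simp [h]
  · have : ((N : ZMod (N + 1)) + 1) = 0 := by
      exact_mod_cast ZMod.natCast_self (N + 1)
    simp [h, this]
  · have : ((N : ZMod (N + 1)) + 1) = 0 := by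
      exact_mod_cast ZMod.natCast_self (N + 1)
    rw [eq_neg_of_add_eq_zero_left this, h1]

end RootedWRAP

theorem crosses_mk {V : Type*} {U : Set V} {x y : V} :
    Crosses U s(x, y) ↔ (x ∈ U ∧ y ∉ U) ∨ (x ∉ U ∧ y ∈ U) := by
  simp only [Crosses, Sym2.mem_iff, exists_eq_or_imp, exists_eq_left]
  tauto

namespace RootedWRAP.RingNumbering

variable {V E : Type*} {I : RootedWRAP V E} {N : ℕ} (R : I.RingNumbering N)

/-- The set of vertices at the positions `c, …, d`. -/
def interval (c d : ℕ) : Set V := {x | c ≤ R.pos x ∧ R.pos x ≤ d}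

variable {R}

theorem vtx_mem_interval {c d k : ℕ} (hk : k ≤ N) : R.vtx k ∈ R.interval c d ↔ c ≤ k ∧ k ≤ d := by
  simp [interval, R.pos_vtx k hk]

theorem vtx_zero : R.vtx 0 = I.r := by
  rw [← R.pos_root, R.vtx_pos]

theorem edge_mem_cutEdges {C : Set V} {k : ℕ} (hk : k < N) :
    R.edge k ∈ cutEdges I.ends C ↔
      (R.vtx k ∈ C ∧ R.vtx (k + 1) ∉ C) ∨ (R.vtx k ∉ C ∧ R.vtx (k + 1) ∈ C) := by
  rw [cutEdges, Set.mem_ofPred_eq, R.ends_edge k hk, crosses_mk]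

theorem edge_last_mem_cutEdges {C : Set V} (hC : I.r ∉ C) :
    R.edge N ∈ cutEdges I.ends C ↔ R.vtx N ∈ C := by
  rw [cutEdges, Set.mem_ofPred_eq, R.ends_last, crosses_mk, vtx_zero]
  tauto

theorem interval_mem_twoCuts {c d : ℕ} (hc : 1 ≤ c) (hcd : c ≤ d) (hd : d ≤ N) :
    R.interval c d ∈ I.twoCuts := by
  have hr : I.r ∉ R.interval c d := by
    rw [← vtx_zero (R := R), vtx_mem_interval (Nat.zero_le N)]
    omega
  refine ⟨hr, ?_⟩
  have : cutEdges I.ends (R.interval c d) = {R.edge (c - 1), R.edge d} := by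
    ext e
    obtain ⟨k, hk, rfl⟩ := R.edge_surj e
    have h1 : R.edge k = R.edge (c - 1) ↔ k = c - 1 :=
      ⟨R.edge_inj k hk (c - 1) (by omega), fun h => by rw [h]⟩
    have h2 : R.edge k = R.edge d ↔ k = d := ⟨R.edge_inj k hk d hd, fun h => by rw [h]⟩
    rw [Set.mem_insert_iff, Set.mem_singleton_iff, h1, h2]
    rcases hk.eq_or_lt with rfl | hk
    · rw [edge_last_mem_cutEdges hr, vtx_mem_interval hk]
      omega
    · rw [edge_mem_cutEdges hk, vtx_mem_interval hk.le, vtx_mem_interval hk]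
      omega
  rw [this, Set.encard_pair]
  intro h
  have := R.edge_inj _ (by omega) _ hd h
  omega

/-- With a and b the extreme positions of C, the edges before a and after b are cut. A hole between
them would produce a third cut edge just before the first missing position. -/
theorem exists_eq_interval {C : Set V} (hC : C ∈ I.twoCuts) :
    ∃ c d, 1 ≤ c ∧ c ≤ d ∧ d ≤ N ∧ C = R.interval c d := by
  classical
  obtain ⟨hr, hcard⟩ := hC
  let W := (Finset.range (N + 1)).filter fun k => R.vtx k ∈ C
  have hW : ∀ k, k ∈ W ↔ k ≤ N ∧ R.vtx k ∈ C := by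
    intro k
    simp [W]
  have hne : W.Nonempty := by
    rw [Finset.nonempty_iff_ne_empty]
    intro h
    have hCe : cutEdges I.ends C = ∅ := by
      rw [Set.eq_empty_iff_forall_notMem]
      rintro e ⟨⟨x, -, hx⟩, -⟩
      have : R.pos x ∈ W := (hW _).2 ⟨R.pos_le x, by rwa [R.vtx_pos]⟩
      rw [h] at this
      exact absurd this (Finset.notMem_empty _)
    rw [hCe, Set.encard_empty] at hcard
    exact absurd hcard (by norm_num)
  have ha := (hW _).1 (W.min'_mem hne)
  have hb := (hW _).1 (W.max'_mem hne)
  have hamin : ∀ k, k ≤ N → R.vtx k ∈ C → W.min' hne ≤ k := fun k h1 h2 =>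
    W.min'_le k ((hW k).2 ⟨h1, h2⟩)
  have hbmax : ∀ k, k ≤ N → R.vtx k ∈ C → k ≤ W.max' hne := fun k h1 h2 =>
    W.le_max' k ((hW k).2 ⟨h1, h2⟩)
  generalize W.min' hne = a at ha hamin
  generalize W.max' hne = b at hb hbmax
  have ha1 : 1 ≤ a := by
    by_contra h
    rw [show a = 0 by omega, vtx_zero] at ha
    exact hr ha.2
  have hab := hamin b hb.1 hb.2
  refine ⟨a, b, ha1, hab, hb.1, ?_⟩
  have hca : R.edge (a - 1) ∈ cutEdges I.ends C := by
    rw [edge_mem_cutEdges (by omega), show a - 1 + 1 = a by omega]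
    exact Or.inr ⟨fun h => by have := hamin _ (by omega) h; omega, ha.2⟩
  have hcb : R.edge b ∈ cutEdges I.ends C := by
    rcases hb.1.eq_or_lt with h | h
    · have := hb.2
      simp only [h] at this ⊢
      exact (edge_last_mem_cutEdges hr).2 this
    · rw [edge_mem_cutEdges h]
      exact Or.inl ⟨hb.2, fun h' => by have := hbmax _ (by omega) h'; omega⟩
  have hall : ∀ m, a ≤ m → m ≤ b → R.vtx m ∈ C := by
    intro m h1 h2
    by_contra hm
    have hex : ∃ m, a ≤ m ∧ R.vtx m ∉ C := ⟨m, h1, hm⟩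
    have hs := Nat.find_spec hex
    have hle := Nat.find_min' hex ⟨h1, hm⟩
    have hmin := fun k => Nat.find_min hex (m := k)
    generalize Nat.find hex = l at hs hle hmin
    have hla : l ≠ a := fun h => hs.2 (h ▸ ha.2)
    have hlb : l ≠ b := fun h => hs.2 (h ▸ hb.2)
    have hl1 : R.vtx (l - 1) ∈ C := by
      by_contra h
      exact hmin (l - 1) (by omega) ⟨by omega, h⟩
    have hcl : R.edge (l - 1) ∈ cutEdges I.ends C := by
      rw [edge_mem_cutEdges (by omega), show l - 1 + 1 = l by omega]
      exact Or.inl ⟨hl1, hs.2⟩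
    have hsub : (({R.edge (a - 1), R.edge (l - 1), R.edge b} : Finset E) : Set E) ⊆
        cutEdges I.ends C := by
      intro e he
      simp only [Finset.coe_insert, Finset.coe_singleton, Set.mem_insert_iff,
        Set.mem_singleton_iff] at he
      rcases he with rfl | rfl | rfl <;> assumption
    have h3 : ({R.edge (a - 1), R.edge (l - 1), R.edge b} : Finset E).card = 3 := by
      rw [Finset.card_eq_three]
      refine ⟨_, _, _, fun h => ?_, fun h => ?_, fun h => ?_, rfl⟩
      · have := R.edge_inj _ (by omega) _ (by omega) h
        omega
      · have := R.edge_inj _ (by omega) _ (by omega) h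
        omega
      · have := R.edge_inj _ (by omega) _ (by omega) h
        omega
    have := Set.encard_le_encard hsub
    rw [Set.encard_coe_eq_coe_finsetCard, h3, hcard] at this
    exact absurd this (by decide)
  ext x
  constructor
  · intro hx
    have hx' : R.vtx (R.pos x) ∈ C := by rwa [R.vtx_pos]
    exact ⟨hamin _ (R.pos_le x) hx', hbmax _ (R.pos_le x) hx'⟩
  · intro hx
    have := hall _ hx.1 hx.2
    rwa [R.vtx_pos] at this

theorem adj_vtx {k : ℕ} (hk : k < N) :
    I.ringWithoutRootEdge.Adj (R.vtx k) (R.vtx (k + 1)) := by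
  refine ⟨fun h => ?_, R.edge k, fun h => ?_, R.ends_edge k hk⟩
  · have := congrArg R.pos h
    rw [R.pos_vtx k hk.le, R.pos_vtx (k + 1) hk] at this
    omega
  · rw [← R.edge_last] at h
    have := R.edge_inj k hk.le N le_rfl h
    omega

theorem exists_isPath {a : ℕ} {b : ℕ} (hab : a ≤ b) (hb : b ≤ N) :
    ∃ p : I.ringWithoutRootEdge.Walk (R.vtx a) (R.vtx b), p.IsPath ∧
      ∀ x, x ∈ p.support ↔ x ∈ R.interval a b := by
  induction b, hab using Nat.le_induction with
  | base =>
    refine ⟨SimpleGraph.Walk.nil, SimpleGraph.Walk.IsPath.nil, fun x => ?_⟩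
    rw [SimpleGraph.Walk.support_nil, List.mem_singleton]
    constructor
    · rintro rfl
      exact (vtx_mem_interval hb).2 ⟨le_rfl, le_rfl⟩
    · rintro ⟨h1, h2⟩
      rw [le_antisymm h1 h2, R.vtx_pos]
  | succ b hab ih =>
    obtain ⟨p, hp, hs⟩ := ih (by omega)
    refine ⟨p.concat (adj_vtx hb), hp.concat ?_ _, fun x => ?_⟩
    · rw [hs, vtx_mem_interval hb]
      omega
    · rw [SimpleGraph.Walk.support_concat, List.mem_append, hs,
        List.mem_singleton]
      constructor
      · rintro (h | rfl)
        · exact ⟨h.1, h.2.trans (Nat.le_succ b)⟩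
        · rw [vtx_mem_interval hb]
          omega
      · rintro ⟨h1, h2⟩
        rcases h2.eq_or_lt with h | h
        · exact Or.inr (by rw [← h, R.vtx_pos])
        · exact Or.inl ⟨h1, by omega⟩

theorem isShortening {u v s : V} (h : (R.pos u ≤ R.pos s ∧ R.pos s < R.pos v) ∨
    (R.pos v < R.pos s ∧ R.pos s ≤ R.pos u)) : I.IsShortening (s, v) (u, v) := by
  refine ⟨fun e => ?_, rfl, ?_⟩
  · simp only at e
    rw [e] at h
    omega
  rcases h with h | h
  · have := exists_isPath (R := R) (a := R.pos u) (b := R.pos v) (by omega) (R.pos_le v)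
    rw [R.vtx_pos, R.vtx_pos] at this
    obtain ⟨p, hp, hs⟩ := this
    exact ⟨p, hp, (hs s).2 ⟨h.1, h.2.le⟩⟩
  · have := exists_isPath (R := R) (a := R.pos v) (b := R.pos u) (by omega) (R.pos_le u)
    rw [R.vtx_pos, R.vtx_pos] at this
    obtain ⟨p, hp, hs⟩ := this
    refine ⟨p.reverse, hp.reverse, ?_⟩
    rw [SimpleGraph.Walk.support_reverse, List.mem_reverse]
    exact (hs s).2 ⟨h.1.le, h.2⟩

end RootedWRAP.RingNumbering

/-! ### Non-shortenable solutions and responsibility. -/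

namespace RootedWRAP.RingNumbering

variable {V E : Type*} {I : RootedWRAP V E} {N : ℕ} {R : I.RingNumbering N}

/-- Times strictly decrease along parents, so from any position of an interval avoiding 0 some
parent step leaves it. The corresponding link starts at least as far out on the same side, so it
enters the interval. -/
theorem isDirectedSolution_of_parent {F : Finset (V × V)} (hloop : ∀ f ∈ F, f.1 ≠ f.2)
    {par t : ℕ → ℕ} (hpar : ∀ v, 1 ≤ v → v ≤ N → t (par v) < t v ∧ par v ≤ N)
    (h : ∀ v, 1 ≤ v → v ≤ N → ∃ f ∈ F, R.pos f.2 = v ∧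
      ((R.pos f.1 ≤ par v ∧ par v < v) ∨ (v < par v ∧ par v ≤ R.pos f.1))) :
    I.IsDirectedSolution F := by
  refine ⟨hloop, fun C hC => ?_⟩
  obtain ⟨c, d, hc, hcd, hd, rfl⟩ := exists_eq_interval (R := R) hC
  have key : ∀ n v, t v = n → c ≤ v → v ≤ d → ∃ f ∈ F, Enters f (R.interval c d) := by
    intro n
    induction n using Nat.strong_induction_on with
    | _ n ih =>
    intro v hn hcv hvd
    have hv := hpar v (by omega) (by omega)
    by_cases hp : c ≤ par v ∧ par v ≤ d
    · exact ih _ (hn ▸ hv.1) _ rfl hp.1 hp.2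
    · obtain ⟨f, hf, h1, h2⟩ := h v (by omega) (by omega)
      refine ⟨f, hf, fun h3 => ?_, ?_⟩
      · have h3 : c ≤ R.pos f.1 ∧ R.pos f.1 ≤ d := h3
        omega
      · exact ⟨by omega, by omega⟩
  exact key _ c rfl le_rfl hcd

/-- Non-shortenable directed solutions are arborescences in which all the vertices strictly
between the endpoints of a link are descendants of its head. -/
theorem exists_parent [DecidableEq V] (R : I.RingNumbering N) {F : Finset (V × V)}
    (hF : I.IsNonShortenable F) :
    ∃ par t : ℕ → ℕ, par 0 = 0 ∧ (∀ v, 1 ≤ v → v ≤ N → t (par v) < t v ∧ par v ≤ N) ∧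
      (∀ f ∈ F, 1 ≤ R.pos f.2 ∧ R.pos f.1 = par (R.pos f.2)) ∧
      ∀ v s, 1 ≤ v → v ≤ N → (par v < s ∧ s < v) ∨ (v < s ∧ s < par v) →
        IsAncestor par v s := by
  obtain ⟨⟨hloop, hcov⟩, hns⟩ := hF
  obtain ⟨par, t, hpar0, hpar⟩ := exists_shortened_arborescence N
    (fun u v => ∃ f ∈ F, R.pos f.1 = u ∧ R.pos f.2 = v) (by
      intro c d hc hcd hd
      obtain ⟨f, hf, h1, h2⟩ := hcov _ (interval_mem_twoCuts (R := R) hc hcd hd)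
      have h1 : ¬ (c ≤ R.pos f.1 ∧ R.pos f.1 ≤ d) := h1
      exact ⟨R.pos f.1, R.pos f.2, ⟨f, hf, rfl, rfl⟩, R.pos_le _, by omega, h2.1, h2.2⟩)
  have hpar' : ∀ v, 1 ≤ v → v ≤ N → t (par v) < t v ∧ par v ≤ N := fun v h1 h2 =>
    ⟨(hpar v h1 h2).1, (hpar v h1 h2).2.1⟩
  have hlink : ∀ v, 1 ≤ v → v ≤ N → ∃ f ∈ F, R.pos f.2 = v ∧
      ((R.pos f.1 ≤ par v ∧ par v < v) ∨ (v < par v ∧ par v ≤ R.pos f.1)) := by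
    intro v h1 h2
    obtain ⟨-, -, u, ⟨f, hf, rfl, hfv⟩, -, h3⟩ := hpar v h1 h2
    exact ⟨f, hf, hfv, h3⟩
  have hhead : ∀ f ∈ F, 1 ≤ R.pos f.2 := by
    intro f hf
    by_contra h0
    -- A link into the root enters no 2-cut, so it could be deleted.
    refine (hns f hf).1 ⟨fun g hg => hloop g (Finset.mem_of_mem_erase hg), fun C hC => ?_⟩
    obtain ⟨g, hg, hgC⟩ := hcov C hC
    refine ⟨g, Finset.mem_erase.2 ⟨?_, hg⟩, hgC⟩
    rintro rfl
    refine hC.1 ?_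
    have : g.2 = I.r := by
      rw [← R.vtx_pos g.2, ← R.vtx_pos I.r, R.pos_root]
      congr 1
      omega
    rw [← this]
    exact hgC.2
  have heq : ∀ f ∈ F, R.pos f.1 = par (R.pos f.2) := by
    intro f hf
    by_contra hne
    have hv := hhead f hf
    have hvN := R.pos_le f.2
    -- If another link serves the same head, f can be deleted; otherwise f itself serves it and can
    -- be strictly shortened to start at the parent.
    by_cases hex : ∃ g ∈ F, g ≠ f ∧ R.pos g.2 = R.pos f.2 ∧
        ((R.pos g.1 ≤ par (R.pos f.2) ∧ par (R.pos f.2) < R.pos f.2) ∨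
          (R.pos f.2 < par (R.pos f.2) ∧ par (R.pos f.2) ≤ R.pos g.1))
    · refine (hns f hf).1 (isDirectedSolution_of_parent (R := R) (par := par) (t := t)
        (fun g hg => hloop g (Finset.mem_of_mem_erase hg)) hpar' fun v h1 h2 => ?_)
      by_cases hvf : v = R.pos f.2
      · obtain ⟨g, hg, hgf, h3, h4⟩ := hex
        subst hvf
        exact ⟨g, Finset.mem_erase.2 ⟨hgf, hg⟩, h3, h4⟩
      · obtain ⟨g, hg, h3, h4⟩ := hlink v h1 h2
        refine ⟨g, Finset.mem_erase.2 ⟨?_, hg⟩, h3, h4⟩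
        rintro rfl
        exact hvf h3.symm
    · obtain ⟨g, hg, h3, h4⟩ := hlink _ hv hvN
      have hgf : g = f := by
        by_contra hgf
        exact hex ⟨g, hg, hgf, h3, h4⟩
      subst hgf
      have hpN := (hpar' _ hv hvN).2
      have hpos := R.pos_vtx _ hpN
      refine (hns g hg).2 (R.vtx (par (R.pos g.2)), g.2) (isShortening (R := R) (by rwa [hpos]))
        (fun h => hne ?_) (isDirectedSolution_of_parent (R := R) (par := par) (t := t) ?_ hpar'
          fun v h1 h2 => ?_)
      · rw [← congrArg Prod.fst h, hpos]
      · intro f hf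
        rcases Finset.mem_insert.1 hf with rfl | hf
        · intro h
          have := congrArg R.pos h
          simp only [hpos] at this
          omega
        · exact hloop f (Finset.mem_of_mem_erase hf)
      · by_cases hvg : v = R.pos g.2
        · subst hvg
          refine ⟨_, Finset.mem_insert_self _ _, rfl, ?_⟩
          simp only [hpos]
          omega
        · obtain ⟨f, hf, h5, h6⟩ := hlink v h1 h2
          refine ⟨f, Finset.mem_insert_of_mem (Finset.mem_erase.2 ⟨?_, hf⟩), h5, h6⟩
          rintro rfl
          exact hvg h5.symm
  refine ⟨par, t, hpar0, hpar', fun f hf => ⟨hhead f hf, heq f hf⟩, ?_⟩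
  intro v s hv hvN hs
  obtain ⟨f, hf, hfv, -⟩ := hlink v hv hvN
  have hfp := heq f hf
  rw [hfv] at hfp
  have hpN := (hpar' v hv hvN).2
  have hsN : s ≤ N := by omega
  have hsp := R.pos_vtx s hsN
  have hg : I.IsShortening (R.vtx s, f.2) f := isShortening (R := R) (u := f.1) (v := f.2)
    (by rw [hsp, hfp, hfv]; omega)
  -- Moving the tail to s leaves some cut C uncovered. Only f covered C before, and s must lie in C.
  have hnot := (hns f hf).2 _ hg (fun h => by
    have := congrArg (fun z => R.pos z.1) h
    simp only [hsp] at this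
    omega)
  have hex : ∃ C ∈ I.twoCuts, ∀ g ∈ insert (R.vtx s, f.2) (F.erase f), ¬ Enters g C := by
    by_contra! hc
    refine hnot ⟨fun g hg' => ?_, hc⟩
    rcases Finset.mem_insert.1 hg' with rfl | hg'
    · exact hg.1
    · exact hloop g (Finset.mem_of_mem_erase hg')
  obtain ⟨C, hC, hCn⟩ := hex
  obtain ⟨f', hf', hfC⟩ := hcov C hC
  obtain rfl : f' = f := by
    by_contra h
    exact hCn f' (Finset.mem_insert_of_mem (Finset.mem_erase.2 ⟨h, hf'⟩)) hfC
  obtain ⟨c, d, hc, hcd, hd, rfl⟩ := exists_eq_interval (R := R) hC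
  have hsC : c ≤ s ∧ s ≤ d := by
    have := hCn _ (Finset.mem_insert_self _ _)
    rw [Enters] at this
    push Not at this
    by_contra hsC
    exact this (by rwa [vtx_mem_interval hsN]) hfC.2
  -- No link other than f enters C, so a path of parents can leave C only from v. Hence all of C,
  -- and s in particular, descends from v.
  have key : ∀ n x, t x = n → c ≤ x → x ≤ d → IsAncestor par v x := by
    intro n
    induction n using Nat.strong_induction_on with
    | _ n ih =>
    intro x hn hcx hxd
    by_cases hxv : x = v
    · exact ⟨0, hxv⟩
    have hx := hpar' x (by omega) (by omega)
    by_cases hp : c ≤ par x ∧ par x ≤ d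
    · exact (ih _ (hn ▸ hx.1) _ rfl hp.1 hp.2).of_par
    · obtain ⟨g, hg, hgx, -⟩ := hlink x (by omega) (by omega)
      have hgp := heq g hg
      rw [hgx] at hgp
      have hgf : g ≠ f' := by
        rintro rfl
        omega
      refine absurd ⟨fun h => hp ?_, ?_⟩ (hCn g (Finset.mem_insert_of_mem
        (Finset.mem_erase.2 ⟨hgf, hg⟩)))
      · rw [← hgp]
        exact h
      · exact ⟨by omega, by omega⟩
  exact key _ s rfl hsC.1 hsC.2

/-- Tails are parents, so an ancestor of b is either an ancestor of a or a vertex of the path, and a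
path starting outside the interval without entering it stays outside. -/
theorem not_mem_of_isAncestor {F : Finset (V × V)} {par : ℕ → ℕ}
    (hF : ∀ f ∈ F, R.pos f.1 = par (R.pos f.2)) {c d : ℕ} (p : List V) {a b : V}
    (ha : p.head? = some a) (hb : p.getLast? = some b) (hp : ∀ f ∈ p.zip p.tail, f ∈ F)
    (hC : ∀ f ∈ p.zip p.tail, ¬ Enters f (R.interval c d))
    (hanc : ∀ z, IsAncestor par z (R.pos a) → ¬ (c ≤ z ∧ z ≤ d)) :
    ∀ z, IsAncestor par z (R.pos b) → ¬ (c ≤ z ∧ z ≤ d) := by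
  induction p generalizing a with
  | nil => simp at ha
  | cons x l ih =>
    obtain rfl : x = a := by simpa using ha
    cases l with
    | nil =>
      obtain rfl : x = b := by simpa using hb
      exact hanc
    | cons y l =>
      simp only [List.tail_cons, List.zip_cons_cons, List.mem_cons, forall_eq_or_imp] at hp hC
      refine ih rfl (by simpa using hb) hp.2 hC.2 fun z hz => ?_
      have hxy := hF _ hp.1
      simp only at hxy
      by_cases hzy : R.pos y = z
      · intro h
        refine hC.1 ⟨hanc _ ⟨0, rfl⟩, ?_⟩
        rw [← hzy] at h
        exact h
      · exact hanc z (hxy ▸ hz.par_of_ne hzy)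

/-- This translates responsibility into the relation D of the core: the path from the root to the
tail never enters the cut, so the cut contains no proper ancestor of the head. -/
theorem responsible_subset {F : Finset (V × V)} {par : ℕ → ℕ} (hpar0 : par 0 = 0)
    (hF : ∀ f ∈ F, R.pos f.1 = par (R.pos f.2)) {c d : ℕ} {f : V × V} (hf : f ∈ F)
    (hc : 1 ≤ c) (h : R.interval c d ∈ I.responsible F f) :
    (c ≤ R.pos f.2 ∧ R.pos f.2 ≤ d) ∧
      ∀ u, c ≤ u → u ≤ d → NoAncestorBetween par (R.pos f.2) u := by
  obtain ⟨-, hent, p, ⟨h1, h2, -, h3⟩, h4⟩ := h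
  have hv : c ≤ R.pos f.2 ∧ R.pos f.2 ≤ d := hent.2
  have hanc := not_mem_of_isAncestor (R := R) hF p h1 h2 h3 h4 (fun z hz => by
    obtain ⟨k, rfl⟩ := hz
    rw [R.pos_root, Function.iterate_fixed hpar0]
    omega)
  refine ⟨hv, fun u hu1 hu2 a ha => ?_⟩
  rw [← hF f hf] at ha
  have := hanc a ha
  omega

end RootedWRAP.RingNumbering

/-! ### Maximal laminar families from recursive splitting. -/

/-- A property of intervals inherited by both parts of a suitable split is satisfied by all the
members of some maximal laminar family of intervals. -/
theorem exists_maximal_laminar_intervals (P : ℕ → ℕ → Prop)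
    (hP : ∀ c d, P c d → c < d → ∃ m, c ≤ m ∧ m < d ∧ P c m ∧ P (m + 1) d) (n : ℕ) :
    ∀ c d, d - c = n → c ≤ d → P c d → ∃ T : ℕ → ℕ → Prop,
      (∀ a b, T a b → c ≤ a ∧ a ≤ b ∧ b ≤ d ∧ P a b) ∧
      (∀ a b a' b', T a b → T a' b' → (a' ≤ a ∧ b ≤ b') ∨ (a ≤ a' ∧ b' ≤ b) ∨ b < a' ∨ b' < a) ∧
      ∀ a b, c ≤ a → a ≤ b → b ≤ d →
        (∀ a' b', T a' b' → (a' ≤ a ∧ b ≤ b') ∨ (a ≤ a' ∧ b' ≤ b) ∨ b < a' ∨ b' < a) → T a b := by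
  induction n using Nat.strong_induction_on with
  | _ n ih =>
  intro c d hn hcd hPcd
  rcases hcd.eq_or_lt with rfl | hlt
  · refine ⟨fun a b => a = c ∧ b = c, ?_, fun a b a' b' h h' => by omega,
      fun a b h1 h2 h3 _ => by omega⟩
    rintro a b ⟨rfl, rfl⟩
    exact ⟨le_rfl, le_rfl, le_rfl, hPcd⟩
  obtain ⟨m, hm1, hm2, hP1, hP2⟩ := hP c d hPcd hlt
  obtain ⟨T₁, h1, h2, h3⟩ := ih (m - c) (by omega) c m rfl hm1 hP1
  obtain ⟨T₂, k1, k2, k3⟩ := ih (d - (m + 1)) (by omega) (m + 1) d rfl hm2 hP2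
  have hT₁ : T₁ c m := h3 c m le_rfl hm1 le_rfl fun a b h => by have := h1 a b h; omega
  have hT₂ : T₂ (m + 1) d := k3 _ _ le_rfl hm2 le_rfl fun a b h => by have := k1 a b h; omega
  refine ⟨fun a b => (a = c ∧ b = d) ∨ T₁ a b ∨ T₂ a b, ?_, ?_, ?_⟩
  · rintro a b (⟨rfl, rfl⟩ | h | h)
    · exact ⟨le_rfl, hcd, le_rfl, hPcd⟩
    · obtain ⟨e1, e2, e3, e4⟩ := h1 a b h
      exact ⟨e1, e2, by omega, e4⟩
    · obtain ⟨e1, e2, e3, e4⟩ := k1 a b h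
      exact ⟨by omega, e2, e3, e4⟩
  · rintro a b a' b' (h | h | h) (h' | h' | h')
    · omega
    · have := h1 _ _ h'; omega
    · have := k1 _ _ h'; omega
    · have := h1 _ _ h; omega
    · exact h2 _ _ _ _ h h'
    · have := h1 _ _ h; have := k1 _ _ h'; omega
    · have := k1 _ _ h; omega
    · have := k1 _ _ h; have := h1 _ _ h'; omega
    · exact k2 _ _ _ _ h h'
  · intro a b hca hab hbd hcomp
    -- Both halves belong to the family, and an interval laminar with both lies in one of them or is
    -- all of [c, d].
    have e1 := hcomp _ _ (Or.inr (Or.inl hT₁))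
    have e2 := hcomp _ _ (Or.inr (Or.inr hT₂))
    by_cases hbm : b ≤ m
    · exact Or.inr (Or.inl (h3 a b hca hab hbm fun a' b' h => hcomp _ _ (Or.inr (Or.inl h))))
    by_cases hma : m + 1 ≤ a
    · exact Or.inr (Or.inr (k3 a b hma hab hbd fun a' b' h => hcomp _ _ (Or.inr (Or.inr h))))
    · exact Or.inl (by omega)

namespace RootedWRAP.RingNumbering

variable {V E : Type*} {I : RootedWRAP V E} {N : ℕ} {R : I.RingNumbering N}

theorem interval_laminar_iff {a b a' b' : ℕ} (hab : a ≤ b) (hb : b ≤ N) (hab' : a' ≤ b')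
    (hb' : b' ≤ N) :
    (R.interval a b ⊆ R.interval a' b' ∨ R.interval a' b' ⊆ R.interval a b ∨
      Disjoint (R.interval a b) (R.interval a' b')) ↔
    (a' ≤ a ∧ b ≤ b') ∨ (a ≤ a' ∧ b' ≤ b) ∨ b < a' ∨ b' < a := by
  have hsub : ∀ {a b a' b' : ℕ}, a ≤ b → b ≤ N →
      (R.interval a b ⊆ R.interval a' b' ↔ a' ≤ a ∧ b ≤ b') := by
    intro a b a' b' hab hb
    refine ⟨fun h => ?_, fun h x hx => ⟨h.1.trans hx.1, hx.2.trans h.2⟩⟩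
    have h1 := h ((vtx_mem_interval (by omega)).2 ⟨le_rfl, hab⟩)
    have h2 := h ((vtx_mem_interval hb).2 ⟨hab, le_rfl⟩)
    rw [vtx_mem_interval (by omega)] at h1 h2
    exact ⟨h1.1, h2.2⟩
  rw [hsub hab hb, hsub hab' hb', Set.disjoint_left]
  refine or_congr_right (or_congr_right ⟨fun h => ?_, fun h x hx hx' => ?_⟩)
  · by_contra! hc
    have hm : max a a' ≤ N := by omega
    exact h ((vtx_mem_interval hm).2 (by omega)) ((vtx_mem_interval hm).2 (by omega))
  · have h1 : a ≤ R.pos x ∧ R.pos x ≤ b := hx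
    have h2 : a' ≤ R.pos x ∧ R.pos x ≤ b' := hx'
    omega

theorem exists_maximal_laminar (R : I.RingNumbering N) {P : ℕ → ℕ → Prop} (h1 : P 1 N)
    (hP : ∀ c d, P c d → c < d → ∃ m, c ≤ m ∧ m < d ∧ P c m ∧ P (m + 1) d) :
    ∃ 𝓛 : Set (Set V),
      Maximal (fun 𝓜 : Set (Set V) => 𝓜 ⊆ I.twoCuts ∧ IsLaminarFamily 𝓜) 𝓛 ∧
      ∀ C ∈ 𝓛, ∃ c d, P c d ∧ C = R.interval c d := by
  obtain ⟨T, hT1, hT2, hT3⟩ := exists_maximal_laminar_intervals P hP _ 1 N rfl R.one_le h1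
  refine ⟨{C | ∃ c d, T c d ∧ C = R.interval c d}, ⟨⟨?_, ?_⟩, ?_⟩, ?_⟩
  · rintro _ ⟨c, d, h, rfl⟩
    obtain ⟨e1, e2, e3, -⟩ := hT1 c d h
    exact interval_mem_twoCuts e1 e2 e3
  · rintro _ ⟨c, d, h, rfl⟩ _ ⟨c', d', h', rfl⟩
    obtain ⟨e1, e2, e3, -⟩ := hT1 c d h
    obtain ⟨k1, k2, k3, -⟩ := hT1 c' d' h'
    exact (interval_laminar_iff e2 e3 k2 k3).2 (hT2 _ _ _ _ h h')
  · rintro 𝓜 ⟨h𝓜, hlam⟩ hsub C hC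
    obtain ⟨c, d, hc, hcd, hd, rfl⟩ := exists_eq_interval (R := R) (h𝓜 hC)
    refine ⟨c, d, hT3 c d hc hcd hd fun c' d' h' => ?_, rfl⟩
    obtain ⟨k1, k2, k3, -⟩ := hT1 c' d' h'
    exact (interval_laminar_iff hcd hd k2 k3).1 (hlam _ hC _ (hsub ⟨c', d', h', rfl⟩))
  · rintro _ ⟨c, d, h, rfl⟩
    exact ⟨c, d, (hT1 c d h).2.2.2, rfl⟩

variable (R) in
/-- The position of the left endpoint of a link. -/
def left (l : Sym2 V) : ℕ := (l.map R.pos).inf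

variable (R) in
/-- The position of the right endpoint of a link. -/
def right (l : Sym2 V) : ℕ := (l.map R.pos).sup

theorem crosses_interval_iff {c d : ℕ} (l : Sym2 V) :
    Crosses (R.interval c d) l ↔ LinkCrosses R.left R.right c d l := by
  induction l with
  | h x y =>
    rw [crosses_mk]
    simp only [LinkCrosses, left, right, Sym2.map_mk, Sym2.inf_mk, Sym2.sup_mk, interval,
      Set.mem_ofPred_eq]
    omega

theorem left_lt_right {l : Sym2 V} (hl : ¬ l.IsDiag) : R.left l < R.right l := by
  induction l with
  | h x y =>
    have : R.pos x ≠ R.pos y := fun h => hl (by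
      rw [Sym2.mk_isDiag_iff, ← R.vtx_pos x, h, R.vtx_pos])
    simp only [left, right, Sym2.map_mk, Sym2.inf_mk, Sym2.sup_mk]
    omega

theorem right_le (l : Sym2 V) : R.right l ≤ N := by
  induction l with
  | h x y =>
    have := R.pos_le x
    have := R.pos_le y
    simp only [right, Sym2.map_mk, Sym2.sup_mk]
    omega

end RootedWRAP.RingNumbering

/-! ### Covering by the solution, and the averaging argument. -/

namespace RootedWRAP

variable {V E : Type*} {I : RootedWRAP V E}

/-- The ring contributes only two of the three edges required across the cut. -/
theorem IsSolution.exists_crosses {S : Finset (Sym2 V)} (hS : I.IsSolution S) {C : Set V}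
    (hC : C ∈ I.twoCuts) : ∃ l ∈ S, Crosses C l := by
  by_contra! hcon
  obtain ⟨hr, hcard⟩ := hC
  have hne : C.Nonempty := by
    by_contra h
    rw [Set.not_nonempty_iff_eq_empty] at h
    subst h
    have : cutEdges I.ends (∅ : Set V) = ∅ := by
      simp [cutEdges, Crosses]
    rw [this, Set.encard_empty] at hcard
    exact absurd hcard (by norm_num)
  have h3 := hS.2 C hne (fun h => hr (h ▸ Set.mem_univ _))
  have hsub : cutEdges (Sum.elim I.ends (fun l : {l : Sym2 V // l ∈ S} => (l : Sym2 V))) C ⊆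
      Sum.inl '' cutEdges I.ends C := by
    rintro (e | l) he
    · exact ⟨e, he, rfl⟩
    · exact absurd he (hcon l l.2)
  have := h3.trans ((Set.encard_le_encard hsub).trans (Set.encard_image_le _ _))
  rw [hcard] at this
  exact absurd this (by decide)

open Classical in
/-- Deleting the cheapest residue class costs at most the average. -/
theorem exists_residue_cost_le (orig : V × V → Sym2 V) (F : Finset (V × V))
    (κ : V × V → ℕ) {q : ℕ} (hq : 0 < q) :
    ∃ s < q, q * I.dirCost orig (F.filter fun f => κ f % q = s) ≤ I.dirCost orig F := by
  by_contra! hcon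
  have h1 : ∑ s ∈ Finset.range q, I.dirCost orig (F.filter fun f => κ f % q = s) =
      I.dirCost orig F :=
    Finset.sum_fiberwise_of_maps_to (fun f _ => Finset.mem_range.2 (Nat.mod_lt _ hq)) _
  have h2 : ∑ _s ∈ Finset.range q, I.dirCost orig F <
      ∑ s ∈ Finset.range q, q * I.dirCost orig (F.filter fun f => κ f % q = s) :=
    Finset.sum_lt_sum_of_nonempty (Finset.nonempty_range_iff.2 hq.ne')
      fun s hs => hcon s (Finset.mem_range.1 hs)
  rw [← Finset.mul_sum, h1, Finset.sum_const, Finset.card_range, nsmul_eq_mul] at h2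
  exact lt_irrefl _ h2

end RootedWRAP

/-! ### Assembly of the decomposition. -/

/-- The partition of a finite set into the fibres of a function. -/
theorem exists_finpartition_fibers {ι : Type*} [DecidableEq ι] (S : Finset ι) (cls : ι → ℕ) :
    ∃ 𝒦 : Finpartition S, ∀ K, K ∈ 𝒦.parts ↔ ∃ x ∈ S, K = S.filter fun y => cls y = cls x := by
  refine ⟨Finpartition.ofExistsUnique (S.image fun x => S.filter fun y => cls y = cls x) ?_ ?_ ?_,
    fun K => ?_⟩
  · intro K hK
    obtain ⟨x, -, rfl⟩ := Finset.mem_image.1 hK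
    exact Finset.filter_subset _ _
  · intro x hx
    refine ⟨S.filter fun y => cls y = cls x, ⟨Finset.mem_image_of_mem _ hx, by simp [hx]⟩, ?_⟩
    rintro K ⟨hK, hxK⟩
    obtain ⟨z, -, rfl⟩ := Finset.mem_image.1 hK
    rw [(Finset.mem_filter.1 hxK).2]
  · intro h
    obtain ⟨x, hx, hx'⟩ := Finset.mem_image.1 h
    have : x ∈ S.filter fun y => cls y = cls x := by simp [hx]
    rw [hx'] at this
    exact absurd this (Finset.notMem_empty _)
  · simp only [Finpartition.ofExistsUnique, Finset.mem_image]
    simp only [eq_comm]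
theorem mainTheorem3 {V E : Type*} [DecidableEq V] (I : RootedWRAP V E)
    (S : Finset (Sym2 V)) (hS : I.IsSolution S)
    (F₀ : Finset (V × V)) (hshadow : (F₀ : Set (V × V)) ⊆ I.shadows)
    (hF₀ : I.IsNonShortenable F₀)
    (orig : V × V → Sym2 V) (horig : I.IsOrigin F₀ orig)
    (ε : ℝ) (hε : 0 < ε) :
    ∃ (𝒦 : Finpartition S) (R : Finset (V × V)),
      R ⊆ F₀ ∧
      (∀ K ∈ 𝒦.parts, I.IsThin (4 * ⌈1 / ε⌉₊) K) ∧
      (∀ f ∈ F₀ \ R, ∃ K ∈ 𝒦.parts, f ∈ I.drop F₀ K) ∧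
      I.dirCost orig R ≤ ε * I.dirCost orig F₀ := by
  classical
  obtain ⟨N, ⟨ν⟩⟩ := I.exists_ringNumbering
  obtain ⟨par, t, hpar0, hpar, hF, hns⟩ := ν.exists_parent hF₀
  have hq : 0 < ⌈1 / ε⌉₊ := Nat.ceil_pos.2 (by positivity)
  have hqε : 1 ≤ ε * (⌈1 / ε⌉₊ : ℝ) := by
    have := mul_le_mul_of_nonneg_left (Nat.le_ceil (1 / ε)) hε.le
    rwa [mul_one_div_cancel hε.ne'] at this
  generalize ⌈1 / ε⌉₊ = q at hq hqε
  obtain ⟨level, hlevel⟩ := exists_level_and_classes N ν.left ν.right S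
    (fun l hl => ν.left_lt_right (I.not_isDiag l (hS.1 hl))) (fun l _ => ν.right_le l)
    (fun c d hc hcd hd => by
      obtain ⟨l, hl, hlc⟩ := hS.exists_crosses (ν.interval_mem_twoCuts hc hcd hd)
      exact ⟨l, hl, (ν.crosses_interval_iff l).1 hlc⟩)
    (NoAncestorBetween par)
    (fun v w _ hv _ hw => noAncestorBetween_antisymm hpar0 hpar hns hv hw)
    (fun v h1 hv => not_noAncestorBetween_zero hpar h1 hv) q
  obtain ⟨s, hs, hcost⟩ := I.exists_residue_cost_le orig F₀ (fun f => level (ν.pos f.2)) hq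
  obtain ⟨cls, hdrop, hthin⟩ := hlevel s hs
  obtain ⟨𝒦, h𝒦⟩ := exists_finpartition_fibers S cls
  refine ⟨𝒦, F₀.filter fun f => level (ν.pos f.2) % q = s, Finset.filter_subset _ _, ?_, ?_, ?_⟩
  · intro K hK
    obtain ⟨x, -, rfl⟩ := (h𝒦 K).1 hK
    obtain ⟨P, hP1, hP2, hP3⟩ := hthin (cls x)
    obtain ⟨𝓛, h𝓛, hP⟩ := ν.exists_maximal_laminar hP1 hP2
    refine ⟨𝓛, h𝓛, fun C hC => ?_⟩
    obtain ⟨c, d, hcd, rfl⟩ := hP C hC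
    have : cutLinks (S.filter fun y => cls y = cls x) (ν.interval c d) =
        ((S.filter fun y => cls y = cls x ∧ LinkCrosses ν.left ν.right c d y :
          Finset (Sym2 V)) : Set (Sym2 V)) := by
      ext l
      simp only [cutLinks, Set.mem_ofPred_eq, Finset.mem_filter, Finset.coe_filter,
        ν.crosses_interval_iff, and_assoc]
    rw [this, Set.encard_coe_eq_coe_finsetCard]
    exact_mod_cast hP3 c d hcd
  · intro f hf
    obtain ⟨hf, hfs⟩ := Finset.mem_sdiff.1 hf
    obtain ⟨x, hx, hcov⟩ := hdrop (ν.pos f.2) (hF f hf).1 (ν.pos_le _)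
      (fun h => hfs (Finset.mem_filter.2 ⟨hf, h⟩))
    refine ⟨_, (h𝒦 _).2 ⟨x, hx, rfl⟩, hf, fun C hC => ?_⟩
    obtain ⟨c, d, hc, hcd, hd, rfl⟩ := ν.exists_eq_interval hC.1
    obtain ⟨⟨h1, h2⟩, h3⟩ := ν.responsible_subset hpar0 (fun f hf => (hF f hf).2) hf hc hC
    obtain ⟨y, hy, hyx, hcr⟩ := hcov c d h1 h2 h3
    exact ⟨y, Finset.mem_filter.2 ⟨hy, hyx⟩, (ν.crosses_interval_iff y).2 hcr⟩
  · have hnn : ∀ G ⊆ F₀, 0 ≤ I.dirCost orig G := fun G hG =>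
      Finset.sum_nonneg fun f hf => I.c_nonneg _ (horig f (hG hf)).1
    have h0 := hnn _ (Finset.filter_subset (fun f => level (ν.pos f.2) % q = s) F₀)
    generalize I.dirCost orig (F₀.filter fun f => level (ν.pos f.2) % q = s) = a at hcost h0
    -- Rounding 1/ε up gives ε q ≥ 1, while q times the cost of the cheapest residue class is at
    -- most the total.
    calc a ≤ ε * q * a := le_mul_of_one_le_left h0 hqε
      _ = ε * (q * a) := by ring
      _ ≤ ε * I.dirCost orig F₀ := mul_le_mul_of_nonneg_left hcost hε.le
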